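/- A convex body in $\mathbb R^2$ is a compact convex set with non-empty interior. Let $K$ and $L$ be convex bodies in $\mathbb R^2$ that are origin-symmetric ($K=-K$ and $L=-L$), and let $D\subset\mathbb R^2$ be a convex body with $D\cap(K\cup L)=\emptyset$. Assume that $D$ is either a polygon (the convex hull of finitely many points) or a body with a $C^2$ support function, that is, $h_D(x)=\max\{\langle x,y\rangle : y\in D\}$ is of class $C^2$ on $\mathbb R^2\setminus\{0\}$. Suppose that for every line $H$ supporting $D$ (that is, $H$ meets $D$ and $D$ is contained in one of the two closed half-planes bounded by $H$) the chords $K\cap H$ and $L\cap H$ have equal length, where an empty chord has length $0$. Then $K=L$. -/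

import Mathlib

open MeasureTheory
open scoped InnerProductSpace

noncomputable section

/-- The Euclidean plane `ℝ²`. -/
abbrev Plane : Type := EuclideanSpace ℝ (Fin 2)

/-- A convex body: a compact convex set with non-empty interior. -/
structure IsConvexBody (K : Set Plane) : Prop where
  convex : Convex ℝ K
  isCompact : IsCompact K
  nonempty_interior : (interior K).Nonempty

/-- `K` is origin-symmetric, i.e. `K = -K`. -/
def IsOriginSymmetric (K : Set Plane) : Prop :=
  ∀ x ∈ K, -x ∈ K

/-- `H` is a supporting line of `E`: a line `{x | ⟪u, x⟫ = c}` (with `u ≠ 0`) that meets `E` and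
for which `E` lies in one of the two closed half-planes bounded by it. Replacing `(u, c)` by
`(-u, -c)` exchanges the two half-planes, so it is enough to write one of them. -/
def IsSupportingLine (H E : Set Plane) : Prop :=
  ∃ (u : Plane) (c : ℝ), u ≠ 0 ∧ H = {x | ⟪u, x⟫_ℝ = c} ∧ (E ∩ H).Nonempty ∧
    ∀ y ∈ E, ⟪u, y⟫_ℝ ≤ c

/-- The support function `h_K(x) = max {⟪x, y⟫ | y ∈ K}`. -/
def supportFun (K : Set Plane) (x : Plane) : ℝ :=
  sSup ((fun y : Plane => ⟪x, y⟫_ℝ) '' K)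

/-- `K` has a `C²` support function: `h_K` is of class `C²` on `ℝ² \ {0}`. -/
def HasC2SupportFun (K : Set Plane) : Prop :=
  ContDiffOn ℝ 2 (supportFun K) {0}ᶜ

/-- `P` is a convex polygon (when it is a convex body): the convex hull of finitely many points. -/
def IsPolygon (P : Set Plane) : Prop :=
  ∃ S : Set Plane, S.Finite ∧ P = convexHull ℝ S

/-- The length of the chord `K ∩ H`, as one-dimensional Hausdorff measure (for a segment this is
the distance between its endpoints; it is `0` when the line misses `K` or meets it in one point). -/
def chordLength (K H : Set Plane) : ENNReal :=
  Measure.hausdorffMeasure 1 (K ∩ H)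

end

/-! Only a strip separating `D` from both bodies matters, which is why no regularity of `D` enters.
In suitable coordinates `D` lies in `x ≤ -k`, the interiors of `K` and `L` lie in `|x| < k`, and the
lines supporting `D` from above are `y = m x + c m`, one for each slope `m`. They cross each other
only where `x ≤ -k`, so they foliate the half-plane `x > -k`; the line of slope `0` passes through
the origin.

Near that line, start from a left boundary point of `K` at height `y`. Its antipode lies on a line
of the family, whose other end on the boundary of `K` has height `y'` with `|y'| ≤ q |y|` and `q <
1`. Since the chord of `L` on that line has the same length, it is a translate of the chord of `K`.
Hence the horizontal gaps `g y` and `g y'` between the two boundaries agree up to sign and a factor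
`1 + O(|y|)`. Iterating, the product of the factors converges while the gap tends to `0`, so `g = 0`
(`exists_leftEnd_eq`, `eq_zero_of_contracting_steps`).

Now let `(α, β)` be a maximal interval of slopes with equal sections. By symmetry the bodies also
agree in the opposite wedge. If the section of slope `β` reaches that wedge, its left end is common
for nearby slopes, and equal lengths give equal sections, against maximality
(`eventually_lineSlice_eq`); likewise at `α`. Symmetry and convexity then leave no room for either
extreme section (`le_of_forall_lineSlice_ge`). Beyond an empty section all sections are empty, so
all sections agree (`eq_of_volume_lineSlice_eq`). -/

/-- A bounded nonempty open convex set of real numbers is the interval between its infimum and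
its supremum. -/
theorem IsOpen.eq_Ioo_of_convex {s : Set ℝ} (ho : IsOpen s) (hc : Convex ℝ s)
    (hb : Bornology.IsBounded s) (hne : s.Nonempty) : s = Set.Ioo (sInf s) (sSup s) := by
  apply Set.Subset.antisymm
  · intro x hx
    obtain ⟨ε, hε, hball⟩ := Metric.isOpen_iff.1 ho x hx
    constructor
    · have h1 : x - ε / 2 ∈ s := hball (by simp [abs_of_pos hε, hε])
      have := csInf_le hb.bddBelow h1
      linarith
    · have h1 : x + ε / 2 ∈ s := hball (by simp [abs_of_pos hε, hε])
      have := le_csSup hb.bddAbove h1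
      linarith
  · exact IsConnected.Ioo_csInf_csSup_subset ⟨hne, hc.isPreconnected⟩ hb.bddBelow hb.bddAbove

theorem IsOpen.eq_of_volume_eq_of_sInf_eq {s t : Set ℝ} (hs : IsOpen s) (ht : IsOpen t)
    (hcs : Convex ℝ s) (hct : Convex ℝ t) (hbs : Bornology.IsBounded s)
    (hbt : Bornology.IsBounded t) (hns : s.Nonempty) (hnt : t.Nonempty)
    (hv : volume s = volume t) (hi : sInf s = sInf t) : s = t := by
  have h1 := hs.eq_Ioo_of_convex hcs hbs hns
  have h2 := ht.eq_Ioo_of_convex hct hbt hnt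
  have l1 : sInf s < sSup s := by rw [h1] at hns; exact Set.nonempty_Ioo.1 hns
  have l2 : sInf t < sSup t := by rw [h2] at hnt; exact Set.nonempty_Ioo.1 hnt
  have h3 : sSup s - sInf s = sSup t - sInf t := by
    rw [h1, h2, Real.volume_Ioo, Real.volume_Ioo,
      ENNReal.ofReal_eq_ofReal_iff (by linarith) (by linarith)] at hv
    exact hv
  have h4 : sSup s = sSup t := by linarith
  rw [h1, h2, hi, h4]

/-! ### The family of lines, its sections, and symmetric domains. -/

/-- The intercepts `c m` of a family of lines `y = m x + c m`, one for each slope `m`, which pass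
through a common vertical strip to the left of `x = -k`. -/
structure IsIntercept (c : ℝ → ℝ) (k S : ℝ) : Prop where
  zero : c 0 = 0
  lower : ∀ m m', m ≤ m' → k * (m' - m) ≤ c m' - c m
  upper : ∀ m m', m ≤ m' → c m' - c m ≤ S * (m' - m)

/-- The abscissas of the points of `U` on the line of slope `m`. -/
def lineSlice (U : Set (ℝ × ℝ)) (c : ℝ → ℝ) (m : ℝ) : Set ℝ :=
  {x | (x, m * x + c m) ∈ U}

/-- A bounded open convex set, symmetric about the origin and containing it. -/
structure IsSymmDomain (U : Set (ℝ × ℝ)) : Prop where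
  isOpen : IsOpen U
  convex : Convex ℝ U
  bounded : Bornology.IsBounded U
  zero_mem : (0, 0) ∈ U
  neg_mem : ∀ x y, (x, y) ∈ U → (-x, -y) ∈ U

theorem mem_lineSlice {U : Set (ℝ × ℝ)} {c : ℝ → ℝ} {m x : ℝ} :
    x ∈ lineSlice U c m ↔ (x, m * x + c m) ∈ U := Iff.rfl

theorem IsIntercept.continuous {c : ℝ → ℝ} {k S : ℝ} (hc : IsIntercept c k S) (hk : 0 < k) :
    Continuous c := by
  have hS : 0 ≤ S := by
    have h1 := hc.lower 0 1 (by norm_num)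
    have h2 := hc.upper 0 1 (by norm_num)
    linarith
  have : LipschitzWith S.toNNReal c := by
    apply LipschitzWith.of_dist_le_mul
    intro x y
    rw [Real.dist_eq, Real.dist_eq, Real.coe_toNNReal _ hS]
    rcases le_total x y with h | h
    · have h1 := hc.lower x y h
      have h2 := hc.upper x y h
      rw [abs_sub_comm x y, abs_of_nonneg (sub_nonneg.2 h), abs_le]
      constructor <;> nlinarith [mul_nonneg hk.le (sub_nonneg.2 h)]
    · have h1 := hc.lower y x h
      have h2 := hc.upper y x h
      rw [abs_of_nonneg (sub_nonneg.2 h), abs_le]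
      constructor <;> nlinarith [mul_nonneg hk.le (sub_nonneg.2 h)]
  exact this.continuous

/-- The reflection `y ↦ -y` exchanges positive and negative slopes, so each statement about `β > 0`
yields its twin about `α < 0`. -/
theorem IsIntercept.reflect {c : ℝ → ℝ} {k S : ℝ} (hc : IsIntercept c k S) :
    IsIntercept (fun m => -c (-m)) k S where
  zero := by simp [hc.zero]
  lower m m' h := by have := hc.lower (-m') (-m) (by linarith); linarith
  upper m m' h := by have := hc.upper (-m') (-m) (by linarith); linarith

/-- Two lines cross at abscissa `-(c m' - c m) / (m' - m) ≤ -k`; to the right of it they are ordered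
by slope. -/
theorem IsIntercept.line_lt {c : ℝ → ℝ} {k S : ℝ} (hc : IsIntercept c k S) {m m' x : ℝ}
    (h : m < m') (hx : -k < x) : m * x + c m < m' * x + c m' := by
  have := hc.lower m m' h.le
  nlinarith [mul_pos (sub_pos.2 h) (by linarith : (0 : ℝ) < x + k)]

theorem IsIntercept.line_lt_iff {c : ℝ → ℝ} {k S : ℝ} (hc : IsIntercept c k S) {m m' x : ℝ}
    (hx : -k < x) : m * x + c m < m' * x + c m' ↔ m < m' := by
  refine ⟨fun h => ?_, fun h => hc.line_lt h hx⟩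
  by_contra h'
  rcases (not_lt.1 h').lt_or_eq with h1 | h1
  · exact absurd (hc.line_lt h1 hx) (by linarith)
  · subst h1; exact lt_irrefl _ h

/-- Through each point to the right of `x = -k` passes a line of the family. -/
theorem IsIntercept.exists_line {c : ℝ → ℝ} {k S : ℝ} (hc : IsIntercept c k S) (hk : 0 < k)
    {x : ℝ} (hx : -k < x) (y : ℝ) : ∃ m, m * x + c m = y := by
  have hcont : Continuous fun m => m * x + c m := by
    have := hc.continuous hk
    fun_prop
  have hpos : 0 < x + k := by linarith
  have hM : 0 ≤ |y| / (x + k) := by positivity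
  have hMe : |y| / (x + k) * (x + k) = |y| := div_mul_cancel₀ _ hpos.ne'
  have h1 := hc.lower 0 (|y| / (x + k)) hM
  have h2 := hc.lower (-(|y| / (x + k))) 0 (by linarith)
  rw [hc.zero] at h1 h2
  have := intermediate_value_Icc (a := -(|y| / (x + k))) (b := |y| / (x + k)) (by linarith)
    hcont.continuousOn
  obtain ⟨m, -, hm⟩ := this (show y ∈ Set.Icc _ _ from
    ⟨by nlinarith [neg_abs_le y], by nlinarith [le_abs_self y]⟩)
  exact ⟨m, hm⟩

theorem lineSlice_isOpen {U : Set (ℝ × ℝ)} (hU : IsOpen U) (c : ℝ → ℝ) (m : ℝ) :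
    IsOpen (lineSlice U c m) :=
  hU.preimage (by fun_prop : Continuous fun x : ℝ => (x, m * x + c m))

theorem lineSlice_convex {U : Set (ℝ × ℝ)} (hU : Convex ℝ U) (c : ℝ → ℝ) (m : ℝ) :
    Convex ℝ (lineSlice U c m) := by
  intro x hx y hy a b ha hb hab
  have := hU hx hy ha hb hab
  rw [mem_lineSlice]
  convert this using 1
  simp only [Prod.smul_mk, Prod.mk_add_mk, smul_eq_mul, Prod.mk.injEq, true_and]
  linear_combination (-(c m)) * hab

theorem lineSlice_isBounded {U : Set (ℝ × ℝ)} (hU : Bornology.IsBounded U) (c : ℝ → ℝ) (m : ℝ) :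
    Bornology.IsBounded (lineSlice U c m) :=
  (hU.image_fst).subset fun _ hx => ⟨_, hx, rfl⟩

/-- The image of a set under the reflection in the axis of abscissas. -/
def reflectSet (U : Set (ℝ × ℝ)) : Set (ℝ × ℝ) := {p | (p.1, -p.2) ∈ U}

theorem mem_reflectSet {U : Set (ℝ × ℝ)} {x y : ℝ} : (x, y) ∈ reflectSet U ↔ (x, -y) ∈ U :=
  Iff.rfl

theorem IsSymmDomain.reflect {U : Set (ℝ × ℝ)} (hU : IsSymmDomain U) :
    IsSymmDomain (reflectSet U) where
  isOpen := hU.isOpen.preimage (by fun_prop : Continuous fun p : ℝ × ℝ => (p.1, -p.2))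
  convex := by
    intro p hp q hq a b ha hb hab
    have := hU.convex hp hq ha hb hab
    change (_, _) ∈ U
    convert this using 1
    simp only [Prod.smul_mk, Prod.mk_add_mk, smul_eq_mul, Prod.mk.injEq, Prod.fst_add,
      Prod.snd_add, Prod.smul_fst, Prod.smul_snd, true_and]
    ring
  bounded := by
    obtain ⟨R, hR⟩ := hU.bounded.exists_norm_le
    refine isBounded_iff_forall_norm_le.2 ⟨R, fun p hp => ?_⟩
    have := hR _ hp
    simpa [Prod.norm_def] using this
  zero_mem := by rw [mem_reflectSet]; simpa using hU.zero_mem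
  neg_mem x y h := hU.neg_mem _ _ h

theorem lineSlice_reflectSet (U : Set (ℝ × ℝ)) (c : ℝ → ℝ) (m : ℝ) :
    lineSlice (reflectSet U) (fun m => -c (-m)) m = lineSlice U c (-m) := by
  ext x
  rw [mem_lineSlice, mem_lineSlice, mem_reflectSet]
  have : -(m * x + -c (-m)) = -m * x + c (-m) := by ring
  rw [this]

/-! ### Iteration along a contraction. -/

/-- A quantity which is nearly non-decreasing along a contraction towards a zero vanishes. -/
theorem eq_zero_of_contracting_steps {g : ℝ → ℝ} {ε C Λ q : ℝ} (hC : 0 ≤ C) (hq0 : 0 ≤ q)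
    (hq : q < 1) (hg : ∀ y, |y| < ε → |g y| ≤ Λ * |y|)
    (hstep : ∀ y, |y| < ε → ∃ y', |y'| ≤ q * |y| ∧ |g y| ≤ (1 + C * |y|) * |g y'|)
    {y : ℝ} (hy : |y| < ε) : g y = 0 := by
  -- The factors collected along the orbit multiply to at most an exponential of a geometric sum,
  -- hence stay bounded, while `|g z|` decays like `q ^ n`.
  have key : ∀ n : ℕ, ∃ z, |z| ≤ q ^ n * |y| ∧
      |g y| ≤ Real.exp (C * |y| * ∑ i ∈ Finset.range n, q ^ i) * |g z| := by
    intro n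
    induction n with
    | zero => exact ⟨y, by simp, by simp⟩
    | succ n ih =>
      obtain ⟨z, hz, hgz⟩ := ih
      have hzε : |z| < ε := by
        have : q ^ n * |y| ≤ 1 * |y| :=
          mul_le_mul_of_nonneg_right (pow_le_one₀ hq0 hq.le) (abs_nonneg y)
        linarith
      obtain ⟨w, hw, hgw⟩ := hstep z hzε
      refine ⟨w, ?_, ?_⟩
      · calc |w| ≤ q * |z| := hw
          _ ≤ q * (q ^ n * |y|) := mul_le_mul_of_nonneg_left hz hq0
          _ = q ^ (n + 1) * |y| := by ring
      · have h1 : 1 + C * |z| ≤ Real.exp (C * |y| * q ^ n) := by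
          have h2 := Real.add_one_le_exp (C * |y| * q ^ n)
          have h3 := mul_le_mul_of_nonneg_left hz hC
          nlinarith
        calc |g y| ≤ Real.exp (C * |y| * ∑ i ∈ Finset.range n, q ^ i) * |g z| := hgz
          _ ≤ Real.exp (C * |y| * ∑ i ∈ Finset.range n, q ^ i) *
              (Real.exp (C * |y| * q ^ n) * |g w|) := by
            refine mul_le_mul_of_nonneg_left (hgw.trans ?_) (Real.exp_pos _).le
            exact mul_le_mul_of_nonneg_right h1 (abs_nonneg _)
          _ = _ := by
            rw [← mul_assoc, ← Real.exp_add, Finset.sum_range_succ]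
            ring_nf
  have hbound : ∀ n : ℕ, |g y| ≤ Real.exp (C * |y| * (1 - q)⁻¹) * (|Λ| * |y|) * q ^ n := by
    intro n
    obtain ⟨z, hz, hgz⟩ := key n
    have hzy : q ^ n * |y| ≤ 1 * |y| :=
      mul_le_mul_of_nonneg_right (pow_le_one₀ hq0 hq.le) (abs_nonneg y)
    have h1 : |g z| ≤ |Λ| * (q ^ n * |y|) := by
      calc |g z| ≤ Λ * |z| := hg z (by linarith)
        _ ≤ |Λ| * |z| := mul_le_mul_of_nonneg_right (le_abs_self _) (abs_nonneg _)
        _ ≤ _ := mul_le_mul_of_nonneg_left hz (abs_nonneg _)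
    have h2 : ∑ i ∈ Finset.range n, q ^ i ≤ (1 - q)⁻¹ := by
      rw [← tsum_geometric_of_lt_one hq0 hq]
      exact (summable_geometric_of_lt_one hq0 hq).sum_le_tsum _ (fun i _ => pow_nonneg hq0 i)
    calc |g y| ≤ Real.exp (C * |y| * ∑ i ∈ Finset.range n, q ^ i) * |g z| := hgz
      _ ≤ Real.exp (C * |y| * (1 - q)⁻¹) * (|Λ| * (q ^ n * |y|)) := by
        gcongr
      _ = _ := by ring
  have hlim := (tendsto_pow_atTop_nhds_zero_of_lt_one hq0 hq).const_mul
    (Real.exp (C * |y| * (1 - q)⁻¹) * (|Λ| * |y|))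
  rw [mul_zero] at hlim
  exact abs_nonpos_iff.1 (ge_of_tendsto' hlim hbound)

/-! ### End points of sections. -/

/-- The abscissa of the left end of the section of `U` by the line `y = m x + t`. -/
noncomputable def leftEnd (U : Set (ℝ × ℝ)) (m t : ℝ) : ℝ := sInf (lineSlice U (fun _ => t) m)

/-- The central symmetry maps the line of intercept `t` to the parallel one of intercept `-t`, so
right ends are opposites of left ends and only left ends need study. -/
theorem lineSlice_eq_Ioo {U : Set (ℝ × ℝ)} (hU : IsSymmDomain U) {m t : ℝ} (h0 : (0, t) ∈ U) :
    lineSlice U (fun _ => t) m = Set.Ioo (leftEnd U m t) (-leftEnd U m (-t)) := by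
  have hne : (lineSlice U (fun _ => t) m).Nonempty := ⟨0, by simpa [mem_lineSlice] using h0⟩
  rw [(lineSlice_isOpen hU.isOpen _ m).eq_Ioo_of_convex (lineSlice_convex hU.convex _ m)
    (lineSlice_isBounded hU.bounded _ m) hne]
  have : lineSlice U (fun _ => -t) m = -lineSlice U (fun _ => t) m := by
    ext x
    rw [Set.mem_neg, mem_lineSlice, mem_lineSlice]
    constructor
    · intro h
      have := hU.neg_mem _ _ h
      convert this using 2
      ring
    · intro h
      have := hU.neg_mem _ _ h
      convert this using 2 <;> ring
  rw [leftEnd, leftEnd, this, Real.sInf_def (-_), neg_neg, neg_neg]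

theorem leftEnd_neg {U : Set (ℝ × ℝ)} (hU : IsSymmDomain U) {m t : ℝ} (h0 : (0, t) ∈ U) :
    leftEnd U m t < 0 := by
  have : (0 : ℝ) ∈ lineSlice U (fun _ => t) m := by simpa [mem_lineSlice] using h0
  rw [lineSlice_eq_Ioo hU h0] at this
  exact this.1

theorem mem_iff_leftEnd {U : Set (ℝ × ℝ)} (hU : IsSymmDomain U) {m t x : ℝ} (h0 : (0, t) ∈ U) :
    (x, m * x + t) ∈ U ↔ leftEnd U m t < x ∧ x < -leftEnd U m (-t) := by
  change x ∈ lineSlice U (fun _ => t) m ↔ _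
  rw [lineSlice_eq_Ioo hU h0]; rfl

theorem neg_ordinate_mem {U : Set (ℝ × ℝ)} (hU : IsSymmDomain U) {t : ℝ} (h0 : (0, t) ∈ U) :
    (0, -t) ∈ U := by
  simpa using hU.neg_mem _ _ h0

/-- The left end of a section depends only on the boundary point, not on the line through it. -/
theorem leftEnd_eq_of_common_point {U : Set (ℝ × ℝ)} (hU : IsSymmDomain U) {m t m' t' : ℝ}
    (h0 : (0, t) ∈ U) (h0' : (0, t') ∈ U)
    (h : m * leftEnd U m t + t = m' * leftEnd U m t + t') : leftEnd U m' t' = leftEnd U m t := by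
  set a := leftEnd U m t with ha
  have ha0 : a < 0 := leftEnd_neg hU h0
  have hb0 : 0 < -leftEnd U m (-t) := by
    have := leftEnd_neg hU (m := m) (neg_ordinate_mem hU h0); linarith
  have hb0' : 0 < -leftEnd U m' (-t') := by
    have := leftEnd_neg hU (m := m') (neg_ordinate_mem hU h0'); linarith
  have hnot : (a, m' * a + t') ∉ U := by
    rw [← h, mem_iff_leftEnd hU h0]
    exact fun h => lt_irrefl _ h.1
  have hcl : (a, m' * a + t') ∈ closure U := by
    rw [← h]
    have hcont : Continuous fun x : ℝ => (x, m * x + t) := by fun_prop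
    have h1 : a ∈ closure (Set.Ioo a 0) := by
      rw [closure_Ioo ha0.ne]; exact ⟨le_rfl, ha0.le⟩
    refine closure_mono ?_ (image_closure_subset_closure_image hcont ⟨a, h1, rfl⟩)
    rintro _ ⟨x, hx, rfl⟩
    exact (mem_iff_leftEnd hU h0).2 ⟨hx.1, hx.2.trans hb0⟩
  rw [mem_iff_leftEnd hU h0'] at hnot
  apply le_antisymm
  · by_contra hlt
    push Not at hlt
    -- The open segment from the interior point `(0, t')` to a point of the closure stays in `U`;
    -- the section of slope `m'` therefore reaches to the left as far as `a`.
    have hseg := hU.convex.openSegment_interior_closure_subset_interior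
      (by rwa [hU.isOpen.interior_eq] : ((0 : ℝ), t') ∈ interior U) hcl
    obtain ⟨x, hx1, hx2⟩ := exists_between (lt_min hlt ha0)
    have hx : (x, m' * x + t') ∈ openSegment ℝ ((0 : ℝ), t') (a, m' * a + t') := by
      refine ⟨1 - x / a, x / a, ?_, ?_, by ring, ?_⟩
      · have : x / a < 1 := (div_lt_one_of_neg ha0).2 hx1
        linarith
      · exact div_pos_of_neg_of_neg (lt_of_lt_of_le hx2 (min_le_right _ _)) ha0
      · have : x / a * a = x := div_mul_cancel₀ _ ha0.ne
        ext
        · simp [this]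
        · simp only [Prod.smul_mk, Prod.mk_add_mk, smul_eq_mul]
          linear_combination m' * this
    have := (mem_iff_leftEnd hU h0').1 (interior_subset (hseg hx))
    have h3 : x < leftEnd U m' t' := lt_of_lt_of_le hx2 (min_le_left _ _)
    linarith [this.1]
  · by_contra hlt
    push Not at hlt
    exact hnot ⟨hlt, by linarith⟩

/-- The left boundary of a convex set is the graph of a convex function of the height. This supplies
the Lipschitz bound near height `0`. -/
theorem convexOn_leftEnd {U : Set (ℝ × ℝ)} (hU : IsSymmDomain U) {ρ : ℝ}
    (hρ : ∀ y, |y| < ρ → (0, y) ∈ U) : ConvexOn ℝ (Set.Ioo (-ρ) ρ) (leftEnd U 0) := by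
  refine ⟨convex_Ioo _ _, ?_⟩
  intro y hy z hz a b ha hb hab
  have hmem : ∀ {w}, w ∈ Set.Ioo (-ρ) ρ → (0, w) ∈ U := fun hw => hρ _ (abs_lt.2 hw)
  have hw := convex_Ioo (-ρ) ρ hy hz ha hb hab
  simp only [smul_eq_mul] at hw ⊢
  -- `U` is open, so the infimum is not attained: points of `U` within `δ` of the boundary are used
  -- instead.
  refine le_of_forall_pos_le_add fun δ hδ => ?_
  have aux : ∀ {w}, (0, w) ∈ U → ∃ x, x < leftEnd U 0 w + δ ∧ (x, w) ∈ U := by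
    intro w hw
    have h1 := leftEnd_neg hU (m := 0) hw
    have h2 := leftEnd_neg hU (m := 0) (neg_ordinate_mem hU hw)
    obtain ⟨x, hx1, hx2⟩ := exists_between
      (lt_min (by linarith : leftEnd U 0 w < leftEnd U 0 w + δ) h1)
    refine ⟨x, hx2.trans_le (min_le_left _ _), ?_⟩
    have := (mem_iff_leftEnd hU (m := 0) hw).2 ⟨hx1, by linarith [hx2.trans_le (min_le_right _ _)]⟩
    simpa using this
  obtain ⟨x1, hx1, hm1⟩ := aux (hmem hy)
  obtain ⟨x2, hx2, hm2⟩ := aux (hmem hz)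
  have h3 := hU.convex hm1 hm2 ha hb hab
  simp only [Prod.smul_mk, Prod.mk_add_mk, smul_eq_mul] at h3
  have h4 := (mem_iff_leftEnd hU (m := 0) (x := a * x1 + b * x2) (hmem hw)).1 (by simpa using h3)
  have e1 := mul_le_mul_of_nonneg_left hx1.le ha
  have e2 := mul_le_mul_of_nonneg_left hx2.le hb
  have e3 : a * δ + b * δ = δ := by rw [← add_mul, hab, one_mul]
  linarith [h4.1]

theorem exists_lipschitz_leftEnd {U : Set (ℝ × ℝ)} (hU : IsSymmDomain U) :
    ∃ ρ > 0, ∃ Λ > 0, (∀ y, |y| < ρ → (0, y) ∈ U) ∧ ∀ y z, |y| < ρ → |z| < ρ →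
      |leftEnd U 0 y - leftEnd U 0 z| ≤ Λ * |y - z| := by
  have hcont : Continuous fun y : ℝ => ((0 : ℝ), y) := by fun_prop
  obtain ⟨ρ, hρ, hball⟩ := Metric.isOpen_iff.1 (hU.isOpen.preimage hcont) 0 hU.zero_mem
  have hρU : ∀ y, |y| < ρ → (0, y) ∈ U := fun y hy => hball (by simpa using hy)
  have hll := (convexOn_leftEnd hU hρU).locallyLipschitzOn isOpen_Ioo
  obtain ⟨Λ, t, ht, hΛ⟩ := hll (show (0 : ℝ) ∈ Set.Ioo (-ρ) ρ from ⟨by linarith, hρ⟩)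
  rw [isOpen_Ioo.nhdsWithin_eq (show (0 : ℝ) ∈ Set.Ioo (-ρ) ρ from ⟨by linarith, hρ⟩)] at ht
  obtain ⟨δ, hδ, hδt⟩ := Metric.mem_nhds_iff.1 ht
  refine ⟨min ρ δ, lt_min hρ hδ, Λ + 1, by positivity, fun y hy => hρU y
    (hy.trans_le (min_le_left _ _)), fun y z hy hz => ?_⟩
  have hy' : y ∈ t := hδt (by simpa using hy.trans_le (min_le_right _ _))
  have hz' : z ∈ t := hδt (by simpa using hz.trans_le (min_le_right _ _))
  have := hΛ.dist_le_mul y hy' z hz'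
  rw [Real.dist_eq, Real.dist_eq] at this
  nlinarith [abs_nonneg (y - z)]

theorem leftEnd_ge {U : Set (ℝ × ℝ)} {k m t : ℝ}
    (hk : ∀ x y, (x, y) ∈ U → |x| < k) (h0 : (0, t) ∈ U) : -k ≤ leftEnd U m t := by
  have hne : (lineSlice U (fun _ => t) m).Nonempty := ⟨0, by simpa [mem_lineSlice] using h0⟩
  exact le_csInf hne fun x hx => (abs_lt.1 (hk _ _ hx)).1.le

theorem leftEnd_add_eq_of_volume_eq {U V : Set (ℝ × ℝ)} (hU : IsSymmDomain U)
    (hV : IsSymmDomain V) {m t : ℝ} (hUt : (0, t) ∈ U) (hVt : (0, t) ∈ V)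
    (h : volume (lineSlice U (fun _ => t) m) = volume (lineSlice V (fun _ => t) m)) :
    leftEnd U m t + leftEnd U m (-t) = leftEnd V m t + leftEnd V m (-t) := by
  have h1 := leftEnd_neg hU (m := m) hUt
  have h2 := leftEnd_neg hU (m := m) (neg_ordinate_mem hU hUt)
  have h3 := leftEnd_neg hV (m := m) hVt
  have h4 := leftEnd_neg hV (m := m) (neg_ordinate_mem hV hVt)
  rw [lineSlice_eq_Ioo hU hUt, lineSlice_eq_Ioo hV hVt, Real.volume_Ioo, Real.volume_Ioo,
    ENNReal.ofReal_eq_ofReal_iff (by linarith) (by linarith)] at h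
  linarith

theorem exists_common_lipschitz_leftEnd {U V : Set (ℝ × ℝ)} (hU : IsSymmDomain U)
    (hV : IsSymmDomain V) :
    ∃ ρ > 0, ∃ Λ > 0, (∀ y, |y| < ρ → (0, y) ∈ U) ∧ (∀ y, |y| < ρ → (0, y) ∈ V) ∧
      (∀ y z, |y| < ρ → |z| < ρ → |leftEnd U 0 y - leftEnd U 0 z| ≤ Λ * |y - z|) ∧
      ∀ y z, |y| < ρ → |z| < ρ → |leftEnd V 0 y - leftEnd V 0 z| ≤ Λ * |y - z| := by
  obtain ⟨ρ, hρ, Λ, hΛ, h1, h2⟩ := exists_lipschitz_leftEnd hU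
  obtain ⟨ρ', hρ', Λ', hΛ', h1', h2'⟩ := exists_lipschitz_leftEnd hV
  refine ⟨min ρ ρ', lt_min hρ hρ', max Λ Λ', lt_max_of_lt_left hΛ,
    fun y hy => h1 y (hy.trans_le (min_le_left _ _)),
    fun y hy => h1' y (hy.trans_le (min_le_right _ _)), fun y z hy hz => ?_, fun y z hy hz => ?_⟩
  · exact (h2 y z (hy.trans_le (min_le_left _ _)) (hz.trans_le (min_le_left _ _))).trans
      (mul_le_mul_of_nonneg_right (le_max_left _ _) (abs_nonneg _))
  · exact (h2' y z (hy.trans_le (min_le_right _ _)) (hz.trans_le (min_le_right _ _))).trans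
      (mul_le_mul_of_nonneg_right (le_max_right _ _) (abs_nonneg _))

/-! ### Agreement near the line through the origin. -/

theorem IsIntercept.abs_slope_mul_le {c : ℝ → ℝ} {k S m x : ℝ} (hc : IsIntercept c k S)
    (hx : x ≤ 0) : |m| * k ≤ |m * x - c m| := by
  rcases le_total 0 m with h | h
  · have h1 := hc.lower 0 m h
    rw [hc.zero] at h1
    rw [abs_of_nonneg h]
    refine le_trans ?_ (neg_le_abs _)
    nlinarith
  · have h1 := hc.lower m 0 h
    rw [hc.zero] at h1
    rw [abs_of_nonpos h]
    refine le_trans ?_ (le_abs_self _)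
    nlinarith

theorem IsIntercept.abs_intercept_le {c : ℝ → ℝ} {k S : ℝ} (hc : IsIntercept c k S)
    (hk : 0 < k) (m : ℝ) : |c m| ≤ S * |m| := by
  rcases le_total 0 m with h | h
  · have h1 := hc.lower 0 m h
    have h2 := hc.upper 0 m h
    rw [hc.zero] at h1 h2
    rw [abs_of_nonneg h, abs_le]
    constructor <;> nlinarith
  · have h1 := hc.lower m 0 h
    have h2 := hc.upper m 0 h
    rw [hc.zero] at h1 h2
    rw [abs_of_nonpos h, abs_le]
    constructor <;> nlinarith

/-- For `m ≥ 0` the height at `a` is `c m - m |a|`, at most `c m - m r / 2`, while the antipode of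
the start has height `c m + m |x| ≥ c m`. As `c m ≤ S m`, subtracting `m r / 2` gains the factor `1
- r / (2 S)`. The bound `-k ≤ a` keeps the new height from changing sign. -/
theorem IsIntercept.contraction {c : ℝ → ℝ} {k S r m x a : ℝ} (hc : IsIntercept c k S)
    (hk : 0 < k) (hkS : k ≤ S) (hr : 0 < r) (hx : x ≤ -(r / 2)) (ha : a ≤ -(r / 2))
    (hak : -k ≤ a) (hrk : r ≤ k) :
    |m * a + c m| ≤ (1 - r / (2 * S)) * |m * x - c m| := by
  have hS : 0 < S := hk.trans_le hkS
  set d := r / (2 * S) with hd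
  have hdS : d * S = r / 2 := by rw [hd]; field_simp
  have hd0 : 0 < d := by positivity
  have hd1 : d ≤ 1 / 2 := by
    rw [hd, div_le_iff₀ (by positivity)]; nlinarith
  rcases le_total 0 m with hm | hm
  · have h1 := hc.lower 0 m hm
    have h2 := hc.upper 0 m hm
    rw [hc.zero] at h1 h2
    have e1 : 0 ≤ m * a + c m := by nlinarith
    have e2 : m * x - c m ≤ 0 := by nlinarith
    rw [abs_of_nonneg e1, abs_of_nonpos e2]
    have e3 : m * x ≤ m * (-(r / 2)) := mul_le_mul_of_nonneg_left hx hm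
    have e4 : m * a ≤ m * (-(r / 2)) := mul_le_mul_of_nonneg_left ha hm
    have e5 : d * c m ≤ d * S * m := by nlinarith
    have e6 : 0 ≤ (1 - d) * (-(m * x)) := mul_nonneg (by linarith) (by nlinarith)
    nlinarith
  · have h1 := hc.lower m 0 hm
    have h2 := hc.upper m 0 hm
    rw [hc.zero] at h1 h2
    have e1 : m * a + c m ≤ 0 := by nlinarith
    have e2 : 0 ≤ m * x - c m := by nlinarith
    rw [abs_of_nonpos e1, abs_of_nonneg e2]
    have e4 : m * (-(r / 2)) ≤ m * a := mul_le_mul_of_nonpos_left ha hm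
    have e5 : d * -(c m) ≤ d * S * -m := by nlinarith
    have e6 : 0 ≤ (1 - d) * (m * x) := mul_nonneg (by linarith) (by nlinarith)
    nlinarith

set_option maxHeartbeats 1000000 in
/-- Two symmetric domains with equal sections along a family of lines agree near the line of the
family through the origin. -/
theorem exists_leftEnd_eq {U V : Set (ℝ × ℝ)} {c : ℝ → ℝ} {k S : ℝ} (hU : IsSymmDomain U)
    (hV : IsSymmDomain V) (hc : IsIntercept c k S) (hk : 0 < k)
    (hUk : ∀ x y, (x, y) ∈ U → |x| < k) (hVk : ∀ x y, (x, y) ∈ V → |x| < k)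
    (hvol : ∀ m, volume (lineSlice U c m) = volume (lineSlice V c m)) :
    ∃ ε > 0, ∀ y, |y| < ε → (0, y) ∈ U ∧ (0, y) ∈ V ∧ leftEnd U 0 y = leftEnd V 0 y := by
  obtain ⟨ρ, hρ, Λ, hΛ, hρU, hρV, hΛU, hΛV⟩ := exists_common_lipschitz_leftEnd hU hV
  have hkS : k ≤ S := by
    have h1 := hc.lower 0 1 (by norm_num)
    have h2 := hc.upper 0 1 (by norm_num)
    linarith
  have hS : 0 < S := hk.trans_le hkS
  have h00 : |(0 : ℝ)| < ρ := by simpa using hρ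
  obtain ⟨r, hr⟩ : ∃ r, r = -leftEnd U 0 0 := ⟨_, rfl⟩
  have hr0 : 0 < r := by rw [hr]; linarith [leftEnd_neg hU (m := 0) (hρU 0 h00)]
  have hrk : r ≤ k := by rw [hr]; linarith [leftEnd_ge (m := 0) hUk (hρU 0 h00)]
  have hUV0 : leftEnd U 0 0 = leftEnd V 0 0 := by
    have h1 : volume (lineSlice U (fun _ => (0 : ℝ)) 0) =
        volume (lineSlice V (fun _ => (0 : ℝ)) 0) := by
      have := hvol 0
      simpa only [lineSlice, hc.zero] using this
    have := leftEnd_add_eq_of_volume_eq hU hV (hρU 0 h00) (hρV 0 h00) h1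
    rw [neg_zero] at this
    linarith
  -- The three bounds serve in turn to keep all heights below `ρ`, to make `u = Λ |y| / k` at most
  -- `1 / 2`, and to keep the left ends at heights `y` and `y'` at most `-r / 2`.
  obtain ⟨ε, hε⟩ : ∃ ε, ε = min (ρ * k / (4 * S)) (min (k / (2 * Λ)) (r * k / (4 * S * Λ))) :=
    ⟨_, rfl⟩
  have hε0 : 0 < ε := by
    rw [hε]; exact lt_min (by positivity) (lt_min (by positivity) (by positivity))
  have hε1 : ε * (4 * S) ≤ ρ * k := by
    rw [← le_div_iff₀ (by positivity), hε]; exact min_le_left _ _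
  have hε2 : ε * (2 * Λ) ≤ k := by
    rw [← le_div_iff₀ (by positivity), hε]; exact (min_le_right _ _).trans (min_le_left _ _)
  have hε3 : ε * (4 * S * Λ) ≤ r * k := by
    rw [← le_div_iff₀ (by positivity), hε]; exact (min_le_right _ _).trans (min_le_right _ _)
  have hερ : ε ≤ ρ := by nlinarith
  have hstep : ∀ y, |y| < ε → ∃ y', |y'| ≤ (1 - r / (2 * S)) * |y| ∧
      |leftEnd U 0 y - leftEnd V 0 y| ≤
        (1 + 4 * Λ / k * |y|) * |leftEnd U 0 y' - leftEnd V 0 y'| := by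
    intro y hy
    have hyρ : |y| < ρ := hy.trans_le hερ
    have hy0 := abs_nonneg y
    obtain ⟨x, hx⟩ : ∃ x, x = leftEnd U 0 y := ⟨_, rfl⟩
    have hx0 : x < 0 := by rw [hx]; exact leftEnd_neg hU (hρU y hyρ)
    -- The line of the family through the antipode `(-x, -y)` of the boundary point `(x, y)`.
    obtain ⟨m, hm⟩ := hc.exists_line hk (x := -x) (by linarith) (-y)
    have hmy : m * x - c m = y := by linarith
    have hmk : |m| * k ≤ |y| := by
      rw [← hmy]; exact hc.abs_slope_mul_le hx0.le
    have hcm : |c m| ≤ S * |m| := hc.abs_intercept_le hk m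
    have hm0 := abs_nonneg m
    have hmkS : |m| * k ≤ |m| * S := mul_le_mul_of_nonneg_left hkS hm0
    have hSm : 0 ≤ S * |m| := by positivity
    have hbig : ∀ s, |s| ≤ 4 * S * |m| → |s| < ρ := by
      intro s hs
      have e1 : |s| * k ≤ 4 * S * (|m| * k) := by
        rw [← mul_assoc]; exact mul_le_mul_of_nonneg_right hs hk.le
      have e2 : 4 * S * (|m| * k) < 4 * S * ε :=
        mul_lt_mul_of_pos_left (hmk.trans_lt hy) (by positivity)
      have : |s| * k < ρ * k := by linarith
      exact lt_of_mul_lt_mul_right this hk.le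
    have hcρ : |c m| < ρ := hbig _ (by linarith)
    have hcU := hρU _ hcρ
    have hcV := hρV _ hcρ
    have hcU' := neg_ordinate_mem hU hcU
    have hcV' := neg_ordinate_mem hV hcV
    have hxm : leftEnd U m (-c m) = x := by
      rw [hx]
      refine leftEnd_eq_of_common_point hU (hρU y hyρ) hcU' ?_
      rw [← hx]; linarith
    obtain ⟨a, ha⟩ : ∃ a, a = leftEnd U m (c m) := ⟨_, rfl⟩
    have hak : -k ≤ a := by rw [ha]; exact leftEnd_ge hUk hcU
    have ha0 : a < 0 := by rw [ha]; exact leftEnd_neg hU hcU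
    have hma : |m * a| ≤ |m| * k := by
      rw [abs_mul]
      exact mul_le_mul_of_nonneg_left (abs_le.2 ⟨hak, by linarith⟩) hm0
    have hy'S : |m * a + c m| ≤ 2 * S * |m| := by
      have := abs_add_le (m * a) (c m)
      linarith
    have hy'ρ : |m * a + c m| < ρ := hbig _ (by linarith)
    have hay' : leftEnd U 0 (m * a + c m) = a := by
      rw [ha]
      exact leftEnd_eq_of_common_point hU hcU (hρU _ (by rw [← ha]; exact hy'ρ)) (by ring)
    -- the displacement of both ends of the chord
    obtain ⟨τ, hτ⟩ : ∃ τ, τ = x - leftEnd V m (-c m) := ⟨_, rfl⟩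
    -- By equality of lengths, the chord of `V` on this line is the chord of `U`, from `a` to `-x`,
    -- translated by `τ` in abscissa.
    have hsum := leftEnd_add_eq_of_volume_eq hU hV hcU hcV (hvol m)
    rw [hxm, ← ha] at hsum
    have hV1 : leftEnd V m (-c m) = x - τ := by linarith
    have hV2 : leftEnd V m (c m) = a + τ := by linarith
    have hτk : |τ| ≤ k := by
      have h1 := leftEnd_ge (m := m) hVk hcV'
      have h2 := leftEnd_neg hV (m := m) hcV'
      have h3 := leftEnd_ge (m := 0) hUk (hρU y hyρ)
      rw [← hx] at h3
      rw [hV1] at h1 h2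
      rw [abs_le]; constructor <;> linarith
    have hmτ : |m * τ| ≤ |m| * k := by
      rw [abs_mul]; exact mul_le_mul_of_nonneg_left hτk hm0
    have hyS : |y| ≤ 2 * S * |m| := by
      rw [← hmy]
      have h3 := leftEnd_ge (m := 0) hUk (hρU y hyρ)
      rw [← hx] at h3
      have h4 : |m * x| ≤ |m| * k := by
        rw [abs_mul]; exact mul_le_mul_of_nonneg_left (abs_le.2 ⟨h3, by linarith⟩) hm0
      have := abs_sub (m * x) (c m)
      linarith
    have hρ1 : |y - m * τ| < ρ := hbig _ (by
      have := abs_sub y (m * τ)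
      linarith)
    have hρ2 : |m * a + c m + m * τ| < ρ := hbig _ (by
      have := abs_add_le (m * a + c m) (m * τ)
      linarith)
    -- The ends of the chord of `V` give boundary points of `V` at heights `y - m τ` and `y' + m τ`;
    -- returning to `y` and `y'` costs at most `Λ |m| |τ| ≤ u |τ|`.
    have hA1 : leftEnd V 0 (y - m * τ) = x - τ := by
      rw [← hV1]
      refine leftEnd_eq_of_common_point hV hcV' (hρV _ hρ1) ?_
      rw [hV1]; linarith
    have hA2 : leftEnd V 0 (m * a + c m + m * τ) = a + τ := by
      rw [← hV2]
      refine leftEnd_eq_of_common_point hV hcV (hρV _ hρ2) ?_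
      rw [hV2]; ring
    have hL1 := hΛV (y - m * τ) y hρ1 hyρ
    have hL2 := hΛV (m * a + c m + m * τ) (m * a + c m) hρ2 hy'ρ
    rw [hA1, show y - m * τ - y = -(m * τ) by ring, abs_neg, abs_mul] at hL1
    rw [hA2, show m * a + c m + m * τ - (m * a + c m) = m * τ by ring, abs_mul] at hL2
    refine ⟨m * a + c m, ?_, ?_⟩
    · rw [← hmy]
      refine hc.contraction hk hkS hr0 ?_ ?_ hak hrk
      · have := hΛU y 0 hyρ h00
        rw [← hx, sub_zero] at this
        have h2 := (abs_le.1 this).2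
        have h3 : Λ * |y| ≤ r / 2 := by
          have e1 : Λ * |y| * k ≤ Λ * ε * S :=
            mul_le_mul (mul_le_mul_of_nonneg_left hy.le hΛ.le) hkS hk.le (by positivity)
          have e2 : 0 ≤ r * k := by positivity
          have : Λ * |y| * k ≤ r / 2 * k := by linarith
          exact le_of_mul_le_mul_right this hk
        linarith
      · have := hΛU (m * a + c m) 0 hy'ρ h00
        rw [hay', sub_zero] at this
        have h2 := (abs_le.1 this).2
        have h3 : Λ * |m * a + c m| ≤ r / 2 := by
          have e1 : Λ * |m * a + c m| * k ≤ Λ * (2 * S) * (|m| * k) := by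
            linarith [mul_le_mul_of_nonneg_left hy'S (mul_pos hΛ hk).le]
          have e2 : Λ * (2 * S) * (|m| * k) ≤ Λ * (2 * S) * ε :=
            mul_le_mul_of_nonneg_left (hmk.trans hy.le) (by positivity)
          have : Λ * |m * a + c m| * k ≤ r / 2 * k := by linarith
          exact le_of_mul_le_mul_right this hk
        linarith
    · rw [hay', ← hx]
      obtain ⟨u, hu⟩ : ∃ u, u = Λ * |y| / k := ⟨_, rfl⟩
      have hu0 : 0 ≤ u := by rw [hu]; positivity
      have hu1 : u ≤ 1 / 2 := by
        rw [hu, div_le_iff₀ hk]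
        linarith [mul_le_mul_of_nonneg_left hy.le hΛ.le]
      have hum : Λ * |m| ≤ u := by
        rw [hu, le_div_iff₀ hk, mul_assoc]; exact mul_le_mul_of_nonneg_left hmk hΛ.le
      have h4 : 4 * Λ / k * |y| = 4 * u := by rw [hu]; ring
      rw [h4]
      have hτ0 := abs_nonneg τ
      have hmul : Λ * (|m| * |τ|) ≤ u * |τ| := by
        rw [← mul_assoc]; exact mul_le_mul_of_nonneg_right hum hτ0
      have h5 : |x - leftEnd V 0 y| ≤ (1 + u) * |τ| := by
        have : x - leftEnd V 0 y = (x - τ - leftEnd V 0 y) + τ := by ring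
        rw [this]
        have := abs_add_le (x - τ - leftEnd V 0 y) τ
        linarith
      have h6 : (1 - u) * |τ| ≤ |a - leftEnd V 0 (m * a + c m)| := by
        have : τ = (a + τ - leftEnd V 0 (m * a + c m)) - (a - leftEnd V 0 (m * a + c m)) := by
          ring
        have h7 : |τ| ≤ |a + τ - leftEnd V 0 (m * a + c m)| +
            |a - leftEnd V 0 (m * a + c m)| := by
          conv_lhs => rw [this]
          exact abs_sub _ _
        linarith
      -- The gap is at most `(1 + u) |τ|` at `y` and at least `(1 - u) |τ|` at `y'`; for `u ≤ 1 / 2`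
      -- the factor `1 + 4 u` absorbs the quotient.
      have h8 : (1 + u) * |τ| ≤ (1 + 4 * u) * ((1 - u) * |τ|) := by
        have : 0 ≤ u * (1 - 2 * u) * |τ| := by
          refine mul_nonneg (mul_nonneg hu0 ?_) hτ0
          linarith
        linarith
      exact h5.trans (h8.trans (mul_le_mul_of_nonneg_left h6 (by linarith)))
  refine ⟨ε, hε0, fun y hy => ⟨hρU y (hy.trans_le hερ), hρV y (hy.trans_le hερ), ?_⟩⟩
  have hq0 : 0 ≤ 1 - r / (2 * S) := by
    rw [sub_nonneg, div_le_one (by positivity)]; linarith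
  have hq1 : 1 - r / (2 * S) < 1 := by
    have : 0 < r / (2 * S) := by positivity
    linarith
  refine sub_eq_zero.1 (eq_zero_of_contracting_steps (g := fun y => leftEnd U 0 y - leftEnd V 0 y)
    (C := 4 * Λ / k) (Λ := 2 * Λ) (by positivity) hq0 hq1 ?_ hstep hy)
  intro z hz
  have h1 := hΛU z 0 (hz.trans_le hερ) h00
  have h2 := hΛV z 0 (hz.trans_le hερ) h00
  rw [sub_zero] at h1 h2
  have : leftEnd U 0 z - leftEnd V 0 z =
      (leftEnd U 0 z - leftEnd U 0 0) - (leftEnd V 0 z - leftEnd V 0 0) := by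
    rw [hUV0]; ring
  rw [this]
  have := abs_sub (leftEnd U 0 z - leftEnd U 0 0) (leftEnd V 0 z - leftEnd V 0 0)
  linarith

/-- Two symmetric domains with equal sections along a family of lines have the same points near
the line of the family through the origin. -/
theorem exists_mem_iff_near_axis {U V : Set (ℝ × ℝ)} {c : ℝ → ℝ} {k S : ℝ} (hU : IsSymmDomain U)
    (hV : IsSymmDomain V) (hc : IsIntercept c k S) (hk : 0 < k)
    (hUk : ∀ x y, (x, y) ∈ U → |x| < k) (hVk : ∀ x y, (x, y) ∈ V → |x| < k)
    (hvol : ∀ m, volume (lineSlice U c m) = volume (lineSlice V c m)) :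
    ∃ ε > 0, ∀ x y, |y| < ε → ((x, y) ∈ U ↔ (x, y) ∈ V) := by
  obtain ⟨ε, hε, h⟩ := exists_leftEnd_eq hU hV hc hk hUk hVk hvol
  refine ⟨ε, hε, fun x y hy => ?_⟩
  obtain ⟨h1, h2, h3⟩ := h y hy
  obtain ⟨-, -, h3'⟩ := h (-y) (by rwa [abs_neg])
  have e1 := mem_iff_leftEnd hU (m := 0) (x := x) h1
  have e2 := mem_iff_leftEnd hV (m := 0) (x := x) h2
  rw [zero_mul, zero_add] at e1 e2
  rw [e1, e2, h3, h3']

/-! ### Propagation to all slopes. -/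

/-- Agreement on a window suffices: a convex set containing `x₁` but not `x₀` has no points to the
left of `x₀`. -/
theorem sInf_eq_of_mem_iff_Icc {s t : Set ℝ} (hs : Convex ℝ s) (ht : Convex ℝ t)
    (hbs : BddBelow s) (hbt : BddBelow t) {x₀ x₁ : ℝ} (h01 : x₀ ≤ x₁) (h₀s : x₀ ∉ s) (h₀t : x₀ ∉ t)
    (h₁s : x₁ ∈ s) (h₁t : x₁ ∈ t) (h : ∀ x, x₀ ≤ x → x ≤ x₁ → (x ∈ s ↔ x ∈ t)) :
    sInf s = sInf t := by
  have aux : ∀ {s t : Set ℝ}, Convex ℝ t → BddBelow s → x₀ ∉ t → x₁ ∈ s → x₁ ∈ t →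
      (∀ x, x₀ ≤ x → x ≤ x₁ → (x ∈ s ↔ x ∈ t)) → sInf s ≤ sInf t := by
    intro s t ht hbs h₀t h₁s h₁t h
    refine le_csInf ⟨x₁, h₁t⟩ fun x hx => ?_
    rcases le_total x x₁ with hx1 | hx1
    · refine csInf_le hbs ((h x ?_ hx1).2 hx)
      by_contra hlt
      push Not at hlt
      exact h₀t (ht.ordConnected.out hx h₁t ⟨hlt.le, h01⟩)
    · exact (csInf_le hbs h₁s).trans hx1
  exact le_antisymm (aux ht hbs h₀t h₁s h₁t h)
    (aux hs hbt h₀s h₁t h₁s fun x h1 h2 => (h x h1 h2).symm)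

/-- If two symmetric domains agree in the wedge opposite to the one between the lines of slopes
`α` and `β`, and the line of slope `β` enters the first domain inside that wedge, then the
sections of slope near `β` agree. -/
theorem eventually_lineSlice_eq {U V : Set (ℝ × ℝ)} {c : ℝ → ℝ} {k S α β : ℝ}
    (hU : IsSymmDomain U) (hV : IsSymmDomain V) (hc : IsIntercept c k S) (hk : 0 < k)
    (hvol : ∀ m, volume (lineSlice U c m) = volume (lineSlice V c m))
    (hα : α < 0) (hβ : 0 < β)
    (hW : ∀ x y, β * x - c β < y → y < α * x - c α → ((x, y) ∈ U ↔ (x, y) ∈ V))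
    {x : ℝ} (hx : x ∈ lineSlice U c β) (hxs : (β - α) * x < -(c α + c β)) :
    ∀ᶠ m in nhds β, lineSlice U c m = lineSlice V c m := by
  have hcc := hc.continuous hk
  have hcβ : 0 < c β := by
    have := hc.lower 0 β hβ.le
    rw [hc.zero] at this
    nlinarith
  set s := lineSlice U c β with hs
  have hso : IsOpen s := lineSlice_isOpen hU.isOpen c β
  have hsI := hso.eq_Ioo_of_convex (lineSlice_convex hU.convex c β)
    (lineSlice_isBounded hU.bounded c β) ⟨x, hx⟩
  set a := sInf s with ha
  have hax : a < x := by rw [hsI] at hx; exact hx.1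
  -- a point of the section inside the wedge, and a point of the line outside the closure
  have hx0 : (a - 1, β * (a - 1) + c β) ∉ closure U := by
    intro hcl
    have hseg := hU.convex.openSegment_interior_closure_subset_interior
      (by rw [hU.isOpen.interior_eq]; exact hx : (x, β * x + c β) ∈ interior U) hcl
    have hmem : (a, β * a + c β) ∈ openSegment ℝ (x, β * x + c β)
        (a - 1, β * (a - 1) + c β) := by
      have hne : x - a + 1 ≠ 0 := by linarith
      refine ⟨1 / (x - a + 1), (x - a) / (x - a + 1), ?_, ?_, ?_, ?_⟩
      · exact div_pos one_pos (by linarith)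
      · exact div_pos (by linarith) (by linarith)
      · field_simp; ring
      · ext
        · simp only [Prod.smul_mk, Prod.mk_add_mk, smul_eq_mul]
          field_simp; ring
        · simp only [Prod.smul_mk, Prod.mk_add_mk, smul_eq_mul]
          field_simp; ring
    have hmem' : (a, β * a + c β) ∈ U := interior_subset (hseg hmem)
    have : a ∈ s := hmem'
    rw [hsI] at this
    exact lt_irrefl _ this.1
  -- The wedge opens to the left, so the line of slope `β`, once inside it, remains there as the
  -- abscissa decreases.
  have hwedge : ∀ x', x' ≤ x → β * x' - c β < β * x' + c β ∧ β * x' + c β < α * x' - c α := by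
    intro x' hx'
    have : (β - α) * x' ≤ (β - α) * x := mul_le_mul_of_nonneg_left hx' (by linarith)
    constructor <;> linarith
  have hcl : ∀ x', Continuous fun m : ℝ => m * x' + c m := fun x' => by fun_prop
  have hcp : ∀ x', Continuous fun m : ℝ => (x', m * x' + c m) := fun x' => by fun_prop
  have e1 : ∀ x' ≤ x, ∀ᶠ m in nhds β,
      β * x' - c β < m * x' + c m ∧ m * x' + c m < α * x' - c α := by
    intro x' hx'
    have h1 := hwedge x' hx'
    exact ((hcl x').continuousAt.eventually (lt_mem_nhds h1.1)).and
      ((hcl x').continuousAt.eventually (gt_mem_nhds h1.2))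
  have e2 : ∀ᶠ m in nhds β, (x, m * x + c m) ∈ U :=
    (hcp x).continuousAt.eventually (hU.isOpen.mem_nhds hx)
  have e3 : ∀ᶠ m in nhds β, (a - 1, m * (a - 1) + c m) ∈ (closure U)ᶜ :=
    (hcp (a - 1)).continuousAt.eventually (isClosed_closure.isOpen_compl.mem_nhds hx0)
  filter_upwards [e1 x le_rfl, e1 (a - 1) (by linarith), e2, e3] with m h1 h2 h3 h4
  -- The wedge is convex and contains both ends of this segment of the line of slope `m`.
  have hagree : ∀ x', a - 1 ≤ x' → x' ≤ x → (x' ∈ lineSlice U c m ↔ x' ∈ lineSlice V c m) := by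
    intro x' hl hr
    obtain ⟨t, ht0, ht1, rfl⟩ : ∃ t, 0 ≤ t ∧ t ≤ 1 ∧ x' = t * x + (1 - t) * (a - 1) := by
      have hpos : 0 < x - (a - 1) := by linarith
      refine ⟨(x' - (a - 1)) / (x - (a - 1)), div_nonneg (by linarith) hpos.le,
        (div_le_one hpos).2 (by linarith), ?_⟩
      have := div_mul_cancel₀ (x' - (a - 1)) hpos.ne'
      linear_combination -this
    have ht1' : 0 ≤ 1 - t := by linarith
    have lc : ∀ p q p' q' : ℝ, p < q → p' < q' →
        t * p + (1 - t) * p' < t * q + (1 - t) * q' := by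
      intro p q p' q' h h'
      rcases ht0.eq_or_lt with e | e
      · rw [← e]; linarith
      · have e4 := mul_lt_mul_of_pos_left h e
        have e5 := mul_le_mul_of_nonneg_left h'.le ht1'
        linarith
    refine hW _ _ ?_ ?_
    · have := lc _ _ _ _ h1.1 h2.1
      linarith
    · have := lc _ _ _ _ h1.2 h2.2
      linarith
  have hxV : x ∈ lineSlice V c m := (hagree x (by linarith) le_rfl).1 h3
  have h0U : a - 1 ∉ lineSlice U c m := fun h => h4 (subset_closure h)
  have h0V : a - 1 ∉ lineSlice V c m := fun h => h0U ((hagree _ le_rfl (by linarith)).2 h)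
  have hbU := lineSlice_isBounded hU.bounded c m
  have hbV := lineSlice_isBounded hV.bounded c m
  have hcU := lineSlice_convex hU.convex c m
  have hcV := lineSlice_convex hV.convex c m
  exact (lineSlice_isOpen hU.isOpen c m).eq_of_volume_eq_of_sInf_eq
    (lineSlice_isOpen hV.isOpen c m) hcU hcV hbU hbV ⟨x, h3⟩ ⟨x, hxV⟩ (hvol m)
    (sInf_eq_of_mem_iff_Icc hcU hcV hbU.bddBelow hbV.bddBelow (by linarith) h0U h0V h3 hxV hagree)

theorem eventually_lineSlice_eq' {U V : Set (ℝ × ℝ)} {c : ℝ → ℝ} {k S α β : ℝ}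
    (hU : IsSymmDomain U) (hV : IsSymmDomain V) (hc : IsIntercept c k S) (hk : 0 < k)
    (hvol : ∀ m, volume (lineSlice U c m) = volume (lineSlice V c m))
    (hα : α < 0) (hβ : 0 < β)
    (hW : ∀ x y, β * x - c β < y → y < α * x - c α → ((x, y) ∈ U ↔ (x, y) ∈ V))
    {x : ℝ} (hx : x ∈ lineSlice U c α) (hxs : (β - α) * x < c α + c β) :
    ∀ᶠ m in nhds α, lineSlice U c m = lineSlice V c m := by
  have := eventually_lineSlice_eq (α := -β) (β := -α) hU.reflect hV.reflect hc.reflect hk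
    (fun m => by rw [lineSlice_reflectSet, lineSlice_reflectSet]; exact hvol _)
    (by linarith) (by linarith) (fun x y h1 h2 => hW _ _ (by
      simp only [neg_neg] at h2; linarith) (by simp only [neg_neg] at h1; linarith))
    (x := x) (by rw [lineSlice_reflectSet, neg_neg]; exact hx)
    (by simp only [neg_neg]; linarith)
  simp only [lineSlice_reflectSet] at this
  have h2 := (continuous_neg.tendsto α).eventually this
  simpa using h2

/-- If the line of slope `α` meets `U` only beyond its intersection with the opposite of the line
of slope `β`, then the latter meets `U` only before the opposite of that point. -/
theorem le_of_forall_lineSlice_ge {U : Set (ℝ × ℝ)} {c : ℝ → ℝ} {k S α β : ℝ}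
    (hU : IsSymmDomain U) (hc : IsIntercept c k S) (hk : 0 < k) (hα : α < 0) (hβ : 0 < β)
    (h : ∀ x ∈ lineSlice U c α, c α + c β ≤ (β - α) * x) {x : ℝ} (hx : x ∈ lineSlice U c β) :
    (β - α) * x ≤ -(c α + c β) := by
  by_contra hlt
  push Not at hlt
  have hcβ : 0 < c β := by
    have := hc.lower 0 β hβ.le
    rw [hc.zero] at this
    nlinarith
  have hcα : c α < 0 := by
    have := hc.lower α 0 hα.le
    rw [hc.zero] at this
    nlinarith
  have hz := hU.neg_mem _ _ hx
  -- `d` is the intercept of the line of slope `α` through the antipode of the given point. It lies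
  -- below `c α < 0`, so shrinking that antipode towards the origin by `t` puts it on the family's
  -- line of slope `α`, at a forbidden abscissa.
  obtain ⟨d, hd⟩ : ∃ d, d = -((β - α) * x) - c β := ⟨_, rfl⟩
  have hd1 : d < c α := by linarith
  have hd0 : d < 0 := by linarith
  obtain ⟨t, ht⟩ : ∃ t, t = c α / d := ⟨_, rfl⟩
  have ht0 : 0 < t := ht ▸ div_pos_of_neg_of_neg hcα hd0
  have ht1 : t < 1 := ht ▸ (div_lt_one_of_neg hd0).2 hd1
  have htd : t * d = c α := ht ▸ div_mul_cancel₀ _ hd0.ne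
  have hw := hU.convex hz hU.zero_mem ht0.le (by linarith : 0 ≤ 1 - t) (by ring)
  have hw' : -(t * x) ∈ lineSlice U c α := by
    rw [mem_lineSlice]
    convert hw using 1
    simp only [Prod.smul_mk, Prod.mk_add_mk, smul_eq_mul, mul_zero, add_zero, Prod.mk.injEq]
    refine ⟨by ring, ?_⟩
    rw [← htd, hd]; ring
  have h1 := h _ hw'
  rw [hd] at htd
  nlinarith

theorem le_of_forall_lineSlice_ge' {U : Set (ℝ × ℝ)} {c : ℝ → ℝ} {k S α β : ℝ}
    (hU : IsSymmDomain U) (hc : IsIntercept c k S) (hk : 0 < k) (hα : α < 0) (hβ : 0 < β)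
    (h : ∀ x ∈ lineSlice U c β, -(c α + c β) ≤ (β - α) * x) {x : ℝ}
    (hx : x ∈ lineSlice U c α) : (β - α) * x ≤ c α + c β := by
  have := le_of_forall_lineSlice_ge (α := -β) (β := -α) hU.reflect hc.reflect hk (by linarith)
    (by linarith) (fun x hx => by
      rw [lineSlice_reflectSet, neg_neg] at hx
      have := h x hx
      simp only [neg_neg]; linarith)
    (x := x) (by rw [lineSlice_reflectSet, neg_neg]; exact hx)
  simp only [neg_neg] at this
  linarith

/-- The line of slope `β` separates, within `x > -k`, the steeper lines from the origin; a segment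
from a point of `U` on a steeper line to the origin would cross it. -/
theorem lineSlice_eq_empty_of_le {U : Set (ℝ × ℝ)} {c : ℝ → ℝ} {k S β m : ℝ}
    (hU : IsSymmDomain U) (hc : IsIntercept c k S) (hk : 0 < k)
    (hUk : ∀ x y, (x, y) ∈ U → |x| < k) (hβ : 0 < β) (h : lineSlice U c β = ∅) (hm : β ≤ m) :
    lineSlice U c m = ∅ := by
  by_contra hne
  obtain ⟨x, hx⟩ := Set.nonempty_iff_ne_empty.2 hne
  have hcβ : 0 < c β := by
    have := hc.lower 0 β hβ.le
    rw [hc.zero] at this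
    nlinarith
  have hxk := (abs_lt.1 (hUk _ _ hx)).1
  obtain ⟨d, hd⟩ : ∃ d, d = m * x + c m - β * x := ⟨_, rfl⟩
  have hd1 : c β ≤ d := by
    rcases hm.eq_or_lt with e | e
    · rw [hd, ← e]; linarith
    · have := hc.line_lt e hxk; linarith
  have hd0 : 0 < d := by linarith
  obtain ⟨t, ht⟩ : ∃ t, t = c β / d := ⟨_, rfl⟩
  have ht0 : 0 < t := ht ▸ div_pos hcβ hd0
  have ht1 : t ≤ 1 := ht ▸ (div_le_one hd0).2 hd1
  have htd : t * d = c β := ht ▸ div_mul_cancel₀ _ hd0.ne'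
  have hw := hU.convex hx hU.zero_mem ht0.le (by linarith : 0 ≤ 1 - t) (by ring)
  have hw' : t * x ∈ lineSlice U c β := by
    rw [mem_lineSlice]
    convert hw using 1
    simp only [Prod.smul_mk, Prod.mk_add_mk, smul_eq_mul, mul_zero, add_zero, Prod.mk.injEq]
    refine ⟨trivial, ?_⟩
    rw [← htd, hd]; ring
  rw [h] at hw'
  exact hw'

theorem lineSlice_eq_empty_of_ge {U : Set (ℝ × ℝ)} {c : ℝ → ℝ} {k S α m : ℝ}
    (hU : IsSymmDomain U) (hc : IsIntercept c k S) (hk : 0 < k)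
    (hUk : ∀ x y, (x, y) ∈ U → |x| < k) (hα : α < 0) (h : lineSlice U c α = ∅) (hm : m ≤ α) :
    lineSlice U c m = ∅ := by
  have := lineSlice_eq_empty_of_le (β := -α) (m := -m) hU.reflect hc.reflect hk
    (fun x y h => hUk _ _ h) (by linarith) (by rw [lineSlice_reflectSet, neg_neg]; exact h)
    (by linarith)
  rwa [lineSlice_reflectSet, neg_neg] at this

/-- A property holding near `0` holds up to some `β > 0` which is either at least `M` or a point
where the property stops holding locally. -/
theorem exists_maximal_of_eventually {P : ℝ → Prop} (h : ∀ᶠ m in nhds 0, P m) (M : ℝ) :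
    ∃ β > 0, (∀ m, 0 ≤ m → m < β → P m) ∧ (M ≤ β ∨ ¬ ∀ᶠ m in nhds β, P m) := by
  by_cases hall : ∀ m, 0 ≤ m → P m
  · exact ⟨max M 1, lt_max_of_lt_right one_pos, fun m h0 _ => hall m h0,
      Or.inl (le_max_left _ _)⟩
  · push Not at hall
    obtain ⟨m₀, hm₀, hPm₀⟩ := hall
    set A := {m : ℝ | 0 ≤ m ∧ ¬ P m} with hA
    have hAne : A.Nonempty := ⟨m₀, hm₀, hPm₀⟩
    have hAb : BddBelow A := ⟨0, fun m hm => hm.1⟩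
    obtain ⟨δ, hδ, hball⟩ := Metric.eventually_nhds_iff.1 h
    have hlow : δ ≤ sInf A := by
      refine le_csInf hAne fun m hm => ?_
      by_contra hlt
      push Not at hlt
      exact hm.2 (hball (by rwa [Real.dist_eq, sub_zero, abs_of_nonneg hm.1]))
    refine ⟨sInf A, by linarith, fun m h0 hm => ?_, Or.inr fun hev => ?_⟩
    · by_contra hP
      exact absurd (csInf_le hAb ⟨h0, hP⟩) (by linarith)
    · obtain ⟨η, hη, hball'⟩ := Metric.eventually_nhds_iff.1 hev
      have : sInf A + η ≤ sInf A := by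
        refine le_csInf hAne fun m hm => ?_
        by_contra hlt
        push Not at hlt
        have := csInf_le hAb hm
        refine hm.2 (hball' ?_)
        rw [Real.dist_eq, abs_of_nonneg (by linarith)]
        linarith
      linarith

/-- Within `|x| < k₀` the line of slope `m` has height at least `|m| (k - k₀)` in absolute value,
which exceeds the size of `U` for steep lines. -/
theorem exists_lineSlice_eq_empty {U : Set (ℝ × ℝ)} {c : ℝ → ℝ} {k₀ k S : ℝ}
    (hU : IsSymmDomain U) (hc : IsIntercept c k S) (hk₀ : k₀ < k)
    (hUk : ∀ x y, (x, y) ∈ U → |x| < k₀) : ∃ M, ∀ m, M ≤ |m| → lineSlice U c m = ∅ := by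
  obtain ⟨R, hR⟩ := hU.bounded.exists_norm_le
  have hpos : 0 < k - k₀ := by linarith
  refine ⟨R / (k - k₀) + 1, fun m hm => ?_⟩
  by_contra hne
  obtain ⟨x, hx⟩ := Set.nonempty_iff_ne_empty.2 hne
  have hxk := (abs_lt.1 (hUk _ _ hx)).1
  have hy : |m * x + c m| ≤ R := (norm_snd_le _).trans (hR _ hx)
  have h1 : R < |m| * (k - k₀) := by
    rw [← div_lt_iff₀ hpos]; linarith
  have hy' := abs_le.1 hy
  rcases le_total 0 m with h | h
  · have h2 := hc.lower 0 m h
    rw [hc.zero] at h2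
    rw [abs_of_nonneg h] at h1
    nlinarith
  · have h2 := hc.lower m 0 h
    rw [hc.zero] at h2
    rw [abs_of_nonpos h] at h1
    nlinarith

theorem eq_empty_of_isOpen_of_subset_singleton {s : Set ℝ} (hs : IsOpen s) {x : ℝ}
    (h : s ⊆ {x}) : s = ∅ := by
  have : volume s = 0 := measure_mono_null h (by simp)
  exact (hs.measure_eq_zero_iff volume).1 this

/-- The antipode of a point of the wedge lies on a line of slope between `α` and `β`, where the
sections agree. -/
theorem mem_iff_of_mem_opposite_wedge {U V : Set (ℝ × ℝ)} {c : ℝ → ℝ} {k S α β : ℝ}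
    (hU : IsSymmDomain U) (hV : IsSymmDomain V) (hc : IsIntercept c k S) (hk : 0 < k)
    (hUk : ∀ x y, (x, y) ∈ U → |x| < k)
    (h : ∀ m, α < m → m < β → lineSlice U c m = lineSlice V c m) {x y : ℝ}
    (h1 : β * x - c β < y) (h2 : y < α * x - c α) (hxy : (x, y) ∈ U) : (x, y) ∈ V := by
  have hxk := (abs_lt.1 (hUk _ _ hxy)).2
  have hlt : -k < -x := by linarith
  obtain ⟨m, hm⟩ := hc.exists_line hk hlt (-y)
  have hm1 : α < m := (hc.line_lt_iff hlt).1 (by linarith)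
  have hm2 : m < β := (hc.line_lt_iff hlt).1 (by linarith)
  have h3 : -x ∈ lineSlice U c m := by
    rw [mem_lineSlice, hm]; exact hU.neg_mem _ _ hxy
  rw [h m hm1 hm2, mem_lineSlice, hm] at h3
  simpa using hV.neg_mem _ _ h3

/-- A symmetric domain is determined by the lengths of its sections by a family of lines. -/
theorem eq_of_volume_lineSlice_eq {U V : Set (ℝ × ℝ)} {c : ℝ → ℝ} {k₀ k S : ℝ}
    (hU : IsSymmDomain U) (hV : IsSymmDomain V) (hc : IsIntercept c k S) (hk : 0 < k)
    (hk₀ : k₀ < k) (hUk₀ : ∀ x y, (x, y) ∈ U → |x| < k₀) (hVk : ∀ x y, (x, y) ∈ V → |x| < k)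
    (hvol : ∀ m, volume (lineSlice U c m) = volume (lineSlice V c m)) : U = V := by
  have hUk : ∀ x y, (x, y) ∈ U → |x| < k := fun x y h => (hUk₀ x y h).trans hk₀
  obtain ⟨M, hM⟩ := exists_lineSlice_eq_empty hU hc hk₀ hUk₀
  have hnear : ∀ᶠ m in nhds 0, lineSlice U c m = lineSlice V c m := by
    obtain ⟨ε, hε, hloc⟩ := exists_mem_iff_near_axis hU hV hc hk hUk hVk hvol
    have hcont : Continuous fun m => |m| * k + |c m| := by
      have := hc.continuous hk
      fun_prop
    have h0 : |(0 : ℝ)| * k + |c 0| < ε := by simpa [hc.zero] using hε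
    filter_upwards [hcont.continuousAt.eventually (gt_mem_nhds h0)] with m hm
    ext x
    rw [mem_lineSlice, mem_lineSlice]
    by_cases hx : |x| < k
    · refine hloc _ _ ((abs_add_le _ _).trans_lt ?_)
      rw [abs_mul]
      nlinarith [mul_le_mul_of_nonneg_left hx.le (abs_nonneg m)]
    · exact ⟨fun h => absurd (hUk _ _ h) hx, fun h => absurd (hVk _ _ h) hx⟩
  obtain ⟨β, hβ, hβP, hβM⟩ := exists_maximal_of_eventually hnear M
  obtain ⟨α', hα', hαP, hαM⟩ := exists_maximal_of_eventually
    (P := fun m => lineSlice U c (-m) = lineSlice V c (-m))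
    ((continuous_neg.tendsto' (0 : ℝ) 0 neg_zero).eventually hnear) M
  obtain ⟨α, rfl⟩ : ∃ α, α' = -α := ⟨-α', by simp⟩
  have hα : α < 0 := by linarith
  have hagree : ∀ m, α < m → m < β → lineSlice U c m = lineSlice V c m := by
    intro m h1 h2
    rcases le_total 0 m with h | h
    · exact hβP m h h2
    · simpa using hαP (-m) (by linarith) (by linarith)
  have hW : ∀ x y, β * x - c β < y → y < α * x - c α → ((x, y) ∈ U ↔ (x, y) ∈ V) :=
    fun x y h1 h2 => ⟨mem_iff_of_mem_opposite_wedge hU hV hc hk hUk hagree h1 h2,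
      mem_iff_of_mem_opposite_wedge hV hU hc hk hVk (fun m h h' => (hagree m h h').symm) h1 h2⟩
  -- Equality holds at `P`, where the line of slope `β` meets the opposite of the line of slope `α`.
  -- A point of the section to the left of `P` would extend the agreement past `β`.
  have hEβ : ∀ x ∈ lineSlice U c β, -(c α + c β) ≤ (β - α) * x := by
    intro x hx
    rcases hβM with h | h
    · rw [hM β (h.trans (le_abs_self _))] at hx; exact absurd hx (Set.notMem_empty _)
    · by_contra hlt
      push Not at hlt
      exact h (eventually_lineSlice_eq hU hV hc hk hvol hα hβ hW hx hlt)
  have hEα : ∀ x ∈ lineSlice U c α, c α + c β ≤ (β - α) * x := by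
    intro x hx
    rcases hαM with h | h
    · rw [hM α (h.trans (neg_le_abs _))] at hx; exact absurd hx (Set.notMem_empty _)
    · by_contra hlt
      push Not at hlt
      have := eventually_lineSlice_eq' hU hV hc hk hvol hα hβ hW hx hlt
      exact h ((continuous_neg.tendsto' (-α) α (neg_neg α)).eventually this)
  have hpos : 0 < β - α := by linarith
  -- Maximality confines the section to one side of `P` and symmetry to the other; an open set of
  -- reals inside a single point is empty.
  have hUβ : lineSlice U c β = ∅ := by
    refine eq_empty_of_isOpen_of_subset_singleton (lineSlice_isOpen hU.isOpen c β)
      (x := -(c α + c β) / (β - α)) fun x hx => ?_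
    have h1 := hEβ x hx
    have h2 := le_of_forall_lineSlice_ge hU hc hk hα hβ hEα hx
    rw [Set.mem_singleton_iff, eq_div_iff hpos.ne']
    linarith
  have hUα : lineSlice U c α = ∅ := by
    refine eq_empty_of_isOpen_of_subset_singleton (lineSlice_isOpen hU.isOpen c α)
      (x := (c α + c β) / (β - α)) fun x hx => ?_
    have h1 := hEα x hx
    have h2 := le_of_forall_lineSlice_ge' hU hc hk hα hβ hEβ hx
    rw [Set.mem_singleton_iff, eq_div_iff hpos.ne']
    linarith
  have hempty : ∀ m, lineSlice U c m = ∅ → lineSlice U c m = lineSlice V c m := by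
    intro m h
    have hv := hvol m
    rw [h, measure_empty] at hv
    rw [h, ((lineSlice_isOpen hV.isOpen c m).measure_eq_zero_iff volume).1 hv.symm]
  have hall : ∀ m, lineSlice U c m = lineSlice V c m := by
    intro m
    rcases le_or_gt β m with h | h
    · exact hempty m (lineSlice_eq_empty_of_le hU hc hk hUk hβ hUβ h)
    · rcases le_or_gt m α with h' | h'
      · exact hempty m (lineSlice_eq_empty_of_ge hU hc hk hUk hα hUα h')
      · exact hagree m h' h
  ext ⟨x, y⟩
  constructor
  · intro h
    obtain ⟨m, hm⟩ := hc.exists_line hk (abs_lt.1 (hUk _ _ h)).1 y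
    have : x ∈ lineSlice U c m := by rw [mem_lineSlice, hm]; exact h
    rw [hall m, mem_lineSlice, hm] at this
    exact this
  · intro h
    obtain ⟨m, hm⟩ := hc.exists_line hk (abs_lt.1 (hVk _ _ h)).1 y
    have : x ∈ lineSlice V c m := by rw [mem_lineSlice, hm]; exact h
    rw [← hall m, mem_lineSlice, hm] at this
    exact this

/-! ### From closed bodies to their interiors. -/

theorem lineSlice_mono {U V : Set (ℝ × ℝ)} (h : U ⊆ V) (c : ℝ → ℝ) (m : ℝ) :
    lineSlice U c m ⊆ lineSlice V c m :=
  fun _ hx => h hx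

theorem volume_lineSlice_interior {K : Set (ℝ × ℝ)} (hK : Convex ℝ K) {c : ℝ → ℝ} {m : ℝ}
    (hne : (lineSlice (interior K) c m).Nonempty) :
    volume (lineSlice (interior K) c m) = volume (lineSlice K c m) := by
  obtain ⟨x₁, hx₁⟩ := hne
  have hconv := lineSlice_convex hK c m
  have hsub : lineSlice (interior K) c m ⊆ lineSlice K c m := lineSlice_mono interior_subset c m
  refine le_antisymm (measure_mono hsub) ?_
  rw [← measure_interior_of_null_frontier (hconv.addHaar_frontier volume)]
  refine measure_mono fun x hx => ?_
  obtain ⟨δ, hδ, hball⟩ := Metric.mem_nhds_iff.1 (mem_interior_iff_mem_nhds.1 hx)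
  -- Prolonging slightly beyond `x` within the section makes `x` an inner point of a segment issuing
  -- from an interior point of `K`.
  obtain ⟨e, he, hlt⟩ : ∃ e > 0, e * |x - x₁| < δ := by
    refine ⟨δ / (|x - x₁| + 1), by positivity, ?_⟩
    rw [div_mul_eq_mul_div, div_lt_iff₀ (by positivity)]
    nlinarith
  have hx₂ : x + e * (x - x₁) ∈ lineSlice K c m := by
    apply hball
    rw [Metric.mem_ball, Real.dist_eq, add_sub_cancel_left, abs_mul, abs_of_pos he]
    exact hlt
  have hseg := hK.openSegment_interior_self_subset_interior hx₁ hx₂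
  refine hseg ⟨e / (1 + e), 1 / (1 + e), by positivity, by positivity, by field_simp; ring, ?_⟩
  ext
  · simp only [Prod.smul_mk, Prod.mk_add_mk, smul_eq_mul]
    field_simp; ring
  · simp only [Prod.smul_mk, Prod.mk_add_mk, smul_eq_mul]
    field_simp; ring

theorem volume_eq_zero_of_forall_le {s : Set ℝ} {a : ℝ} (h : ∀ x ∈ s, x = a) : volume s = 0 :=
  measure_mono_null (t := {a}) (fun x hx => h x hx) (by simp)

/-- A line that misses the interior of `K` may still cut a chord of positive length along an edge,
so one compares nearby lines. If the interior of `L` met this line, it would meet slightly steeper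
ones, giving `K` positive chords there. But `K` lies on the origin's side of the line, and steeper
lines can touch it only at `x = -k`. -/
theorem lineSlice_interior_eq_empty {K L : Set (ℝ × ℝ)} {c : ℝ → ℝ} {k S : ℝ} (hk : 0 < k)
    (hU : IsSymmDomain (interior K)) (hV : IsSymmDomain (interior L)) (hc : IsIntercept c k S)
    (hKcl : K ⊆ closure (interior K)) (hUk : ∀ x y, (x, y) ∈ interior K → |x| < k)
    (hvol : ∀ m, volume (lineSlice K c m) = volume (lineSlice L c m)) {m : ℝ}
    (h : lineSlice (interior K) c m = ∅) : lineSlice (interior L) c m = ∅ := by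
  by_contra hne
  obtain ⟨x, hx⟩ := Set.nonempty_iff_ne_empty.2 hne
  have hcont : Continuous fun m : ℝ => (x, m * x + c m) := by
    have := hc.continuous hk
    fun_prop
  have hev : ∀ᶠ m' in nhds m, x ∈ lineSlice (interior L) c m' :=
    hcont.continuousAt.eventually (hV.isOpen.mem_nhds hx)
  have hpos : ∀ {m'}, x ∈ lineSlice (interior L) c m' → volume (lineSlice K c m') ≠ 0 := by
    intro m' hm' h0
    rw [hvol] at h0
    have h1 : volume (lineSlice (interior L) c m') = 0 :=
      measure_mono_null (lineSlice_mono interior_subset c m') h0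
    rw [(lineSlice_isOpen hV.isOpen c m').measure_eq_zero_iff volume] at h1
    rw [h1] at hm'
    exact hm'
  have hm0 : m ≠ 0 := by
    rintro rfl
    have : (0 : ℝ) ∈ lineSlice (interior K) c 0 := by
      rw [mem_lineSlice, hc.zero]; simpa using hU.zero_mem
    rw [h] at this
    exact this
  have hxK : ∀ p ∈ K, -k ≤ p.1 := by
    intro p hp
    refine closure_minimal (t := {p : ℝ × ℝ | -k ≤ p.1}) (fun q hq => ?_)
      (isClosed_le continuous_const continuous_fst) (hKcl hp)
    exact (abs_lt.1 (hUk q.1 q.2 hq)).1.le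
  rcases hm0.lt_or_gt with hm | hm
  · have hside : ∀ p ∈ K, m * p.1 + c m ≤ p.2 := by
      intro p hp
      refine closure_minimal (t := {p : ℝ × ℝ | m * p.1 + c m ≤ p.2}) (fun q hq => ?_)
        (isClosed_le (by fun_prop) continuous_snd) (hKcl hp)
      have hqk := (abs_lt.1 (hUk q.1 q.2 hq)).1
      obtain ⟨m', hm'⟩ := hc.exists_line hk hqk q.2
      have hq' : q.1 ∈ lineSlice (interior K) c m' := by rw [mem_lineSlice, hm']; exact hq
      have hlt : m < m' := by
        by_contra hle
        rw [lineSlice_eq_empty_of_ge hU hc hk hUk hm h (not_lt.1 hle)] at hq'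
        exact hq'
      have := hc.line_lt hlt hqk
      rw [hm'] at this
      exact this.le
    obtain ⟨m', hxm', hlt⟩ := ((hev.filter_mono nhdsWithin_le_nhds).and
      (self_mem_nhdsWithin : Set.Iio m ∈ nhdsWithin m (Set.Iio m))).exists
    refine hpos hxm' (volume_eq_zero_of_forall_le (a := -k) fun z hz => ?_)
    have h1 := hxK _ hz
    have h2 := hside _ hz
    by_contra hzk
    have := hc.line_lt hlt (lt_of_le_of_ne h1 (Ne.symm hzk))
    dsimp only at h2
    linarith
  · have hside : ∀ p ∈ K, p.2 ≤ m * p.1 + c m := by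
      intro p hp
      refine closure_minimal (t := {p : ℝ × ℝ | p.2 ≤ m * p.1 + c m}) (fun q hq => ?_)
        (isClosed_le continuous_snd (by fun_prop)) (hKcl hp)
      have hqk := (abs_lt.1 (hUk q.1 q.2 hq)).1
      obtain ⟨m', hm'⟩ := hc.exists_line hk hqk q.2
      have hq' : q.1 ∈ lineSlice (interior K) c m' := by rw [mem_lineSlice, hm']; exact hq
      have hlt : m' < m := by
        by_contra hle
        rw [lineSlice_eq_empty_of_le hU hc hk hUk hm h (not_lt.1 hle)] at hq'
        exact hq'
      have := hc.line_lt hlt hqk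
      rw [hm'] at this
      exact this.le
    obtain ⟨m', hxm', hlt⟩ := ((hev.filter_mono nhdsWithin_le_nhds).and
      (self_mem_nhdsWithin : Set.Ioi m ∈ nhdsWithin m (Set.Ioi m))).exists
    refine hpos hxm' (volume_eq_zero_of_forall_le (a := -k) fun z hz => ?_)
    have h1 := hxK _ hz
    have h2 := hside _ hz
    by_contra hzk
    have := hc.line_lt hlt (lt_of_le_of_ne h1 (Ne.symm hzk))
    dsimp only at h2
    linarith

theorem interior_eq_of_volume_lineSlice_eq {K L : Set (ℝ × ℝ)} {c : ℝ → ℝ} {k₀ k S : ℝ}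
    (hk : 0 < k) (hk₀ : k₀ < k) (hK : Convex ℝ K) (hL : Convex ℝ L)
    (hU : IsSymmDomain (interior K)) (hV : IsSymmDomain (interior L)) (hc : IsIntercept c k S)
    (hKcl : K ⊆ closure (interior K)) (hLcl : L ⊆ closure (interior L))
    (hUk : ∀ x y, (x, y) ∈ interior K → |x| < k₀)
    (hVk : ∀ x y, (x, y) ∈ interior L → |x| < k)
    (hvol : ∀ m, volume (lineSlice K c m) = volume (lineSlice L c m)) :
    interior K = interior L := by
  have hUk' : ∀ x y, (x, y) ∈ interior K → |x| < k := fun x y h => (hUk x y h).trans hk₀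
  refine eq_of_volume_lineSlice_eq hU hV hc hk hk₀ hUk hVk fun m => ?_
  by_cases h : lineSlice (interior K) c m = ∅
  · rw [h, lineSlice_interior_eq_empty hk hU hV hc hKcl hUk' hvol h]
  · have h' : lineSlice (interior L) c m ≠ ∅ := fun h' =>
      h (lineSlice_interior_eq_empty hk hV hU hc hLcl hVk (fun m => (hvol m).symm) h')
    rw [volume_lineSlice_interior hK (Set.nonempty_iff_ne_empty.2 h),
      volume_lineSlice_interior hL (Set.nonempty_iff_ne_empty.2 h'), hvol m]

/-! ### Chords and supporting lines in linear coordinates. -/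

theorem hausdorffMeasure_image_smul_add (d p : Plane) (s : Set ℝ) :
    Measure.hausdorffMeasure 1 ((fun x : ℝ => x • d + p) '' s) = ‖d‖₊ • volume s := by
  have h1 : (fun x : ℝ => x • d + p) '' s = (fun q => q + p) '' ((fun x : ℝ => x • d) '' s) := by
    rw [Set.image_image]
  rw [h1, (isometry_add_right p).hausdorffMeasure_image (Or.inl zero_le_one),
    hausdorffMeasure_smul_right_image, hausdorffMeasure_real]

theorem isSupportingLine_of_linear {D : Set Plane} {f : Plane →L[ℝ] ℝ} (hf : f ≠ 0) {w : ℝ}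
    {T : Plane} (hT : T ∈ D) (hTw : f T = w) (hD : ∀ p ∈ D, f p ≤ w) :
    IsSupportingLine {p | f p = w} D := by
  have hin : ∀ p, inner ℝ ((InnerProductSpace.toDual ℝ Plane).symm f) p = f p := fun p =>
    InnerProductSpace.toDual_symm_apply
  refine ⟨(InnerProductSpace.toDual ℝ Plane).symm f, w, ?_, ?_, ⟨T, hT, hTw⟩, ?_⟩
  · simpa using hf
  · ext p; simp only [Set.mem_ofPred_eq, hin]
  · intro p hp; rw [hin]; exact hD p hp

theorem zero_mem_interior_of_symm {K : Set Plane} (hK : IsConvexBody K)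
    (hs : IsOriginSymmetric K) :
    (0 : Plane) ∈ interior K ∧ ∀ p ∈ interior K, -p ∈ interior K := by
  have hneg : ∀ p ∈ interior K, -p ∈ interior K := by
    intro p hp
    have hpre : (Homeomorph.neg Plane) ⁻¹' K = K := by
      ext q
      refine ⟨fun hq => ?_, fun hq => hs q hq⟩
      have := hs _ hq
      simpa using this
    have := (Homeomorph.neg Plane).preimage_interior K
    rw [hpre] at this
    rw [← this] at hp
    exact hp
  refine ⟨?_, hneg⟩
  obtain ⟨p, hp⟩ := hK.nonempty_interior
  have := hK.convex.interior hp (hneg p hp) (by norm_num : (0 : ℝ) ≤ 1 / 2)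
    (by norm_num : (0 : ℝ) ≤ 1 / 2) (by norm_num)
  simpa using this

/-- The intercept of the line of slope `m` supporting `D` from above. -/
noncomputable def supportIntercept (D : Set (ℝ × ℝ)) (m : ℝ) : ℝ :=
  sSup ((fun p : ℝ × ℝ => p.2 - m * p.1) '' D)

theorem supportIntercept_spec {D : Set (ℝ × ℝ)} (hD : IsCompact D) (hne : D.Nonempty) (m : ℝ) :
    (∃ q ∈ D, q.2 - m * q.1 = supportIntercept D m) ∧
      ∀ p ∈ D, p.2 - m * p.1 ≤ supportIntercept D m := by
  have hcont : ContinuousOn (fun p : ℝ × ℝ => p.2 - m * p.1) D := by fun_prop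
  obtain ⟨q, hq, hsup⟩ := hD.exists_sSup_image_eq hne hcont
  exact ⟨⟨q, hq, hsup.symm⟩, fun p hp => le_csSup (hD.image_of_continuousOn hcont).bddAbove
    ⟨p, hp, rfl⟩⟩

/-- A point `q` attaining the maximum for one slope bounds the increment of the intercept by `-(m' -
m) * q.1`, from below if `q` belongs to `m` and from above if to `m'`; and `-q.1` lies between `k`
and the radius `S` of `D`. -/
theorem exists_isIntercept_supportIntercept {D : Set (ℝ × ℝ)} (hD : IsCompact D) {k : ℝ}
    (hDk : ∀ p ∈ D, p.1 ≤ -k) (hD0 : ∀ p ∈ D, p.2 ≤ 0) {T : ℝ × ℝ} (hT : T ∈ D)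
    (hT0 : T.2 = 0) : ∃ S, IsIntercept (supportIntercept D) k S := by
  obtain ⟨S, hS⟩ := hD.isBounded.exists_norm_le
  have hspec := supportIntercept_spec hD ⟨T, hT⟩
  refine ⟨S, ⟨?_, fun m m' h => ?_, fun m m' h => ?_⟩⟩
  · obtain ⟨⟨q, hq, hqe⟩, hle⟩ := hspec 0
    have h1 := hle T hT
    have h2 := hD0 q hq
    rw [zero_mul, sub_zero] at hqe h1
    linarith
  · obtain ⟨⟨q, hq, hqe⟩, -⟩ := hspec m
    have h1 := (hspec m').2 q hq
    have h2 := hDk q hq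
    nlinarith
  · obtain ⟨⟨q, hq, hqe⟩, -⟩ := hspec m'
    have h1 := (hspec m).2 q hq
    have h2 := (abs_le.1 ((norm_fst_le q).trans (hS q hq))).1
    nlinarith

/-- The lengths of the chords of a plane set, in terms of the sections of its coordinate image. -/
theorem chordLength_eq_volume_lineSlice (e : Plane ≃L[ℝ] ℝ × ℝ) (K : Set Plane) (c : ℝ → ℝ)
    (m : ℝ) : chordLength K {p | (e p).2 - m * (e p).1 = c m} =
      ‖e.symm (1, m)‖₊ • volume (lineSlice (e.symm ⁻¹' K) c m) := by
  rw [← hausdorffMeasure_image_smul_add _ (e.symm (0, c m)), chordLength]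
  congr 1
  have hγ : ∀ x : ℝ, x • e.symm (1, m) + e.symm (0, c m) = e.symm (x, m * x + c m) := by
    intro x
    rw [← map_smul, ← map_add]
    congr 1
    simp [mul_comm]
  ext p
  constructor
  · rintro ⟨hp, hpl⟩
    have hpl' : (e p).2 - m * (e p).1 = c m := hpl
    have hpe : e.symm ((e p).1, m * (e p).1 + c m) = p := by
      rw [e.symm_apply_eq]
      ext
      · rfl
      · simp only; linarith
    refine ⟨(e p).1, ?_, ?_⟩
    · rw [mem_lineSlice, Set.mem_preimage, hpe]; exact hp
    · dsimp only; rw [hγ, hpe]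
  · rintro ⟨x, hx, rfl⟩
    dsimp only
    rw [hγ]
    refine ⟨hx, ?_⟩
    simp

theorem IsConvexBody.isSymmDomain_preimage {K : Set Plane} (hK : IsConvexBody K)
    (hs : IsOriginSymmetric K) (e : Plane ≃L[ℝ] ℝ × ℝ) :
    IsSymmDomain (interior (e.symm ⁻¹' K)) := by
  have hpre : interior (e.symm ⁻¹' K) = e.symm ⁻¹' interior K :=
    (e.symm.toHomeomorph.preimage_interior K).symm
  obtain ⟨h0, hneg⟩ := zero_mem_interior_of_symm hK hs
  refine ⟨isOpen_interior, ?_, ?_, ?_, ?_⟩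
  · exact (hK.convex.linear_preimage e.symm.toLinearEquiv.toLinearMap).interior
  · have : IsCompact (e.symm ⁻¹' K) := e.symm.toHomeomorph.isCompact_preimage.2 hK.isCompact
    exact this.isBounded.subset interior_subset
  · rw [hpre]
    change e.symm 0 ∈ interior K
    rw [map_zero]; exact h0
  · intro x y h
    rw [hpre] at h ⊢
    have := hneg _ h
    rw [← map_neg] at this
    exact this

/-- Uniqueness in coordinates in which the first coordinate separates `D` from `K`, and `D`
touches the first axis from below. -/
theorem interior_eq_of_coordinates {K L D : Set Plane} (hK : IsConvexBody K)
    (hL : IsConvexBody L) (hKsymm : IsOriginSymmetric K) (hLsymm : IsOriginSymmetric L)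
    (hD : IsConvexBody D)
    (hchord : ∀ H : Set Plane, IsSupportingLine H D → chordLength K H = chordLength L H)
    (e : Plane ≃L[ℝ] ℝ × ℝ) {k₀ k : ℝ} (hk : 0 < k) (hk₀ : k₀ < k)
    (hDk : ∀ p ∈ D, (e p).1 ≤ -k) (hD0 : ∀ p ∈ D, (e p).2 ≤ 0) {T : Plane} (hT : T ∈ D)
    (hT0 : (e T).2 = 0) (hKk : ∀ p ∈ interior K, |(e p).1| < k₀)
    (hLk : ∀ p ∈ interior L, |(e p).1| < k) : interior K = interior L := by
  have hDc : IsCompact (e.symm ⁻¹' D) := e.symm.toHomeomorph.isCompact_preimage.2 hD.isCompact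
  have hTD : e T ∈ e.symm ⁻¹' D := by simpa using hT
  obtain ⟨S, hc⟩ := exists_isIntercept_supportIntercept hDc (k := k)
    (fun p hp => by simpa using hDk _ hp) (fun p hp => by simpa using hD0 _ hp) hTD hT0
  have hspec := supportIntercept_spec hDc ⟨_, hTD⟩
  set c := supportIntercept (e.symm ⁻¹' D) with hcdef
  have hint : ∀ M : Set Plane, interior (e.symm ⁻¹' M) = e.symm ⁻¹' interior M := fun M =>
    (e.symm.toHomeomorph.preimage_interior M).symm
  have hconv : ∀ M : Set Plane, IsConvexBody M → Convex ℝ (e.symm ⁻¹' M) := fun M hM =>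
    hM.convex.linear_preimage e.symm.toLinearEquiv.toLinearMap
  have hclos : ∀ M : Set Plane, IsConvexBody M →
      e.symm ⁻¹' M ⊆ closure (interior (e.symm ⁻¹' M)) := by
    intro M hM
    rw [(hconv M hM).closure_interior_eq_closure_of_nonempty_interior]
    · exact subset_closure
    · rw [hint]
      obtain ⟨p, hp⟩ := hM.nonempty_interior
      exact ⟨e p, by simpa using hp⟩
  have hvol : ∀ m, volume (lineSlice (e.symm ⁻¹' K) c m) =
      volume (lineSlice (e.symm ⁻¹' L) c m) := by
    intro m
    let f : Plane →L[ℝ] ℝ := (ContinuousLinearMap.snd ℝ ℝ ℝ).comp (e : Plane →L[ℝ] ℝ × ℝ) -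
      m • (ContinuousLinearMap.fst ℝ ℝ ℝ).comp (e : Plane →L[ℝ] ℝ × ℝ)
    have hf : ∀ p, f p = (e p).2 - m * (e p).1 := fun p => by simp [f]
    have hf0 : f ≠ 0 := by
      intro h
      have h1 := hf (e.symm (0, 1))
      rw [h] at h1
      simp at h1
    obtain ⟨⟨q, hq, hqe⟩, hle⟩ := hspec m
    have hle' : ∀ p ∈ D, f p ≤ c m := by
      intro p hp
      rw [hf]
      exact hle (e p) (by rw [Set.mem_preimage, e.symm_apply_apply]; exact hp)
    have hsl := isSupportingLine_of_linear hf0 (T := e.symm q) hq (by rw [hf]; simpa using hqe)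
      hle'
    simp only [hf] at hsl
    have := hchord _ hsl
    rw [chordLength_eq_volume_lineSlice, chordLength_eq_volume_lineSlice, ENNReal.smul_def,
      ENNReal.smul_def, smul_eq_mul, smul_eq_mul] at this
    -- Both chord lengths carry the same nonzero factor, the length of the direction vector.
    refine (ENNReal.mul_right_inj ?_ ENNReal.coe_ne_top).1 this
    simp
  have := interior_eq_of_volume_lineSlice_eq hk hk₀ (hconv K hK) (hconv L hL)
    (hK.isSymmDomain_preimage hKsymm e) (hL.isSymmDomain_preimage hLsymm e) hc
    (hclos K hK) (hclos L hL)
    (fun x y h => by rw [hint] at h; simpa using hKk _ h)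
    (fun x y h => by rw [hint] at h; simpa using hLk _ h) hvol
  rw [hint, hint] at this
  exact e.symm.surjective.preimage_injective this

/-! ### Choice of coordinates and conclusion. -/

/-- A nonzero linear form on the plane is the first coordinate of a linear coordinate system,
whose second coordinate may be chosen so that `D`, on which the form is negative, touches the
first axis from below. -/
theorem exists_coordinates {D : Set Plane} (hD : IsCompact D) (hne : D.Nonempty)
    {f : Plane →L[ℝ] ℝ} (hfD : ∀ p ∈ D, f p < 0) :
    ∃ e : Plane ≃L[ℝ] ℝ × ℝ, (∀ p, (e p).1 = f p) ∧ (∀ p ∈ D, (e p).2 ≤ 0) ∧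
      ∃ T ∈ D, (e T).2 = 0 := by
  obtain ⟨n, hn⟩ : ∃ n, n = (InnerProductSpace.toDual ℝ Plane).symm f := ⟨_, rfl⟩
  have hfn : ∀ p, f p = n 0 * p 0 + n 1 * p 1 := by
    intro p
    rw [← InnerProductSpace.toDual_symm_apply (𝕜 := ℝ) (x := p) (y := f), ← hn]
    simp [PiLp.inner_apply, Fin.sum_univ_two, mul_comm]
  let g : Plane →L[ℝ] ℝ := n 0 • EuclideanSpace.proj (1 : Fin 2) - n 1 • EuclideanSpace.proj 0
  have hg : ∀ p, g p = n 0 * p 1 - n 1 * p 0 := fun p => by simp [g]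
  have hcont : ContinuousOn (fun p => g p / f p) D :=
    g.continuous.continuousOn.div f.continuous.continuousOn fun p hp => (hfD p hp).ne
  obtain ⟨T, hT, hmin⟩ := hD.exists_isMinOn hne hcont
  -- The shear by `σ` turns the line through the origin supporting `D` at `T` into the first axis;
  -- as `f < 0` on `D`, minimality of the quotient gives `g - σ f ≤ 0` there.
  obtain ⟨σ, hσ⟩ : ∃ σ, σ = g T / f T := ⟨_, rfl⟩
  let E : Plane →ₗ[ℝ] ℝ × ℝ := (f : Plane →ₗ[ℝ] ℝ).prod ((g - σ • f : Plane →L[ℝ] ℝ) : Plane →ₗ[ℝ] ℝ)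
  have hE1 : ∀ p, (E p).1 = f p := fun p => rfl
  have hE2 : ∀ p, (E p).2 = g p - σ * f p := fun p => by simp [E]
  have hnpos : 0 < n 0 ^ 2 + n 1 ^ 2 := by
    by_contra h
    have h0 : n 0 = 0 := by nlinarith [sq_nonneg (n 0), sq_nonneg (n 1)]
    have h1 : n 1 = 0 := by nlinarith [sq_nonneg (n 0), sq_nonneg (n 1)]
    have := hfD T hT
    rw [hfn, h0, h1] at this
    simp at this
  have hinj : Function.Injective E := by
    rw [injective_iff_map_eq_zero]
    intro p hp
    have h1 : f p = 0 := by rw [← hE1, hp]; rfl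
    have h2 : g p = 0 := by
      have := hE2 p
      rw [hp, h1] at this
      simpa using this.symm
    rw [hfn] at h1
    rw [hg] at h2
    have e0 : (n 0 ^ 2 + n 1 ^ 2) * p 0 = 0 := by linear_combination n 0 * h1 - n 1 * h2
    have e1 : (n 0 ^ 2 + n 1 ^ 2) * p 1 = 0 := by linear_combination n 1 * h1 + n 0 * h2
    ext i
    fin_cases i
    · simpa [hnpos.ne'] using e0
    · simpa [hnpos.ne'] using e1
  let e := (LinearMap.linearEquivOfInjective E hinj (by simp)).toContinuousLinearEquiv
  have he : ∀ p, e p = E p := fun p => rfl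
  refine ⟨e, fun p => by rw [he, hE1], fun p hp => ?_, T, hT, ?_⟩
  · rw [he, hE2]
    have h1 : σ ≤ g p / f p := hσ ▸ hmin hp
    have h2 := (le_div_iff_of_neg (hfD p hp)).1 h1
    linarith
  · rw [he, hE2, hσ, div_mul_cancel₀ _ (hfD T hT).ne, sub_self]

/-- A line through an interior point of a set cuts a chord of positive length. -/
theorem chordLength_ne_zero {L : Set Plane} {f : Plane →L[ℝ] ℝ} {d p : Plane} (hd : d ≠ 0)
    (hfd : f d = 0) (hp : p ∈ interior L) : chordLength L {q | f q = f p} ≠ 0 := by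
  have hcont : Continuous fun x : ℝ => x • d + p := by fun_prop
  have hopen : IsOpen ((fun x : ℝ => x • d + p) ⁻¹' interior L) := isOpen_interior.preimage hcont
  have hpos : volume ((fun x : ℝ => x • d + p) ⁻¹' interior L) ≠ 0 :=
    (hopen.measure_pos volume ⟨0, by simpa using hp⟩).ne'
  intro h
  have hsub : (fun x : ℝ => x • d + p) '' ((fun x : ℝ => x • d + p) ⁻¹' interior L) ⊆
      L ∩ {q | f q = f p} := by
    rintro _ ⟨x, hx, rfl⟩
    exact ⟨interior_subset hx, by simp [hfd]⟩
  have h0 := measure_mono_null hsub h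
  rw [hausdorffMeasure_image_smul_add, ENNReal.smul_def, smul_eq_mul, mul_eq_zero] at h0
  rcases h0 with h0 | h0
  · simp [hd] at h0
  · exact hpos h0

/-- Origin-symmetric convex bodies in the plane are determined by the lengths of their chords on the
lines supporting a convex body disjoint from them. No regularity of that body is needed, so the
hypothesis `hDtype` is not used. -/
theorem mainTheorem10 (K L D : Set Plane)
    (hK : IsConvexBody K) (hL : IsConvexBody L)
    (hKsymm : IsOriginSymmetric K) (hLsymm : IsOriginSymmetric L)
    (hD : IsConvexBody D) (hDtype : IsPolygon D ∨ HasC2SupportFun D)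
    (hout : Disjoint D (K ∪ L))
    (hchord : ∀ H : Set Plane, IsSupportingLine H D → chordLength K H = chordLength L H) :
    K = L := by
  have hDK : Disjoint D K := hout.mono_right Set.subset_union_left
  obtain ⟨f, u, v, hDu, huv, hKv⟩ := geometric_hahn_banach_compact_closed hD.convex hD.isCompact
    hK.convex hK.isCompact.isClosed hDK
  have hDne : D.Nonempty := hD.nonempty_interior.mono interior_subset
  obtain ⟨T₀, hT₀, hmax⟩ := hD.isCompact.exists_isMaxOn hDne f.continuous.continuousOn
  obtain ⟨h0K, hnegK⟩ := zero_mem_interior_of_symm hK hKsymm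
  obtain ⟨h0L, hnegL⟩ := zero_mem_interior_of_symm hL hLsymm
  have hv0 : v < 0 := by
    have := hKv 0 (interior_subset h0K)
    rwa [map_zero] at this
  have hTu := hDu T₀ hT₀
  obtain ⟨e, he1, he2, T, hT, hT0⟩ := exists_coordinates hD.isCompact hDne
    (f := f) (fun p hp => by linarith [hDu p hp])
  have hf0 : f ≠ 0 := by
    rintro rfl
    simp at hTu
    linarith
  -- The line `f = f T₀` supports `D` and misses `K`, so its chord of `L` has length `0`. An
  -- interior point of `L` on or beyond it could be shrunk towards the origin onto this line, giving
  -- a chord of positive length.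
  have hLw : ∀ p ∈ interior L, f T₀ < f p := by
    intro p hp
    by_contra hle
    push Not at hle
    have hp0 : f p < 0 := by linarith
    have ht0 : 0 ≤ f T₀ / f p := (div_pos_of_neg_of_neg (by linarith) hp0).le
    have ht1 : f T₀ / f p ≤ 1 := (div_le_one_of_neg hp0).2 hle
    have hq := hL.convex.interior hp h0L ht0 (sub_nonneg.2 ht1) (by ring)
    have hfq : f ((f T₀ / f p) • p + (1 - f T₀ / f p) • (0 : Plane)) = f T₀ := by
      rw [smul_zero, add_zero, map_smul, smul_eq_mul, div_mul_cancel₀ _ hp0.ne]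
    have hd : e.symm (0, 1) ≠ 0 := by simp
    have hfd : f (e.symm (0, 1)) = 0 := by rw [← he1]; simp
    have hne := chordLength_ne_zero (f := f) hd hfd hq
    rw [hfq, ← hchord _ (isSupportingLine_of_linear hf0 hT₀ rfl fun p hp => hmax hp)] at hne
    apply hne
    have hempty : K ∩ {q | f q = f T₀} = ∅ := by
      ext q
      simp only [Set.mem_inter_iff, Set.mem_ofPred_eq, Set.mem_empty_iff_false, iff_false]
      rintro ⟨hq, hqe⟩
      linarith [hKv q hq]
    rw [chordLength, hempty, measure_empty]
  have hint : interior K = interior L := by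
    -- The gap `k₀ < k` is that between `v`, a lower bound of `f` on `K`, and the maximum `f T₀` of
    -- `f` on `D`; symmetry turns the one-sided bounds on `f` into bounds on `|f|`.
    refine interior_eq_of_coordinates hK hL hKsymm hLsymm hD hchord e (k₀ := -v) (k := -f T₀)
      (by linarith) (by linarith) (fun p hp => ?_) he2 hT hT0 (fun p hp => ?_) (fun p hp => ?_)
    · rw [he1, neg_neg]; exact hmax hp
    · rw [he1, abs_lt]
      have h1 := hKv p (interior_subset hp)
      have h2 := hKv (-p) (interior_subset (hnegK p hp))
      rw [map_neg] at h2
      constructor <;> linarith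
    · rw [he1, abs_lt]
      have h1 := hLw p hp
      have h2 := hLw (-p) (hnegL p hp)
      rw [map_neg] at h2
      constructor <;> linarith
  rw [← hK.isCompact.isClosed.closure_eq, ← hL.isCompact.isClosed.closure_eq,
    ← hK.convex.closure_interior_eq_closure_of_nonempty_interior hK.nonempty_interior,
    ← hL.convex.closure_interior_eq_closure_of_nonempty_interior hL.nonempty_interior, hint]
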